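/- \textbf{Setting.} Let $n,k\ge 0$ be integers and $N=n+k$. Let $R$ be an integral domain and let $\beta,t_1,\dots,t_N\in R$ be such that all $1+\beta t_j$ and all differences $t_i-t_j$ ($i\ne j$) are invertible in $R$ (for example $\beta,t_1,\dots,t_N$ indeterminates and $R=\mathbb{Q}(\beta,t_1,\dots,t_N)$). Let $q$ and $x$ be further indeterminates, and put $$a\oplus b=a+b+\beta ab,\qquad a\ominus b=\frac{a-b}{1+\beta b}.$$ Let $V$ be free with basis $v_0,v_1$, with operators $\sigma^-v_1=v_0$, $\sigma^-v_0=0$, $\sigma^+v_0=v_1$, $\sigma^+v_1=0$, and write $\sigma_j^\pm$ for their action on the $j$-th factor of $V^{\otimes N}$. Let $V_n\subset V^{\otimes N}$ be spanned by the $v_b=v_{b_1}\otimes\cdots\otimes v_{b_N}$ with $b\in\{0,1\}^N$, $\sum_j b_j=n$, and let $V_n^q=R[[q]]\otimes V_n$, with dual $(V_n^q)^*$ spanned by the dual basis vectors $\tilde v_b$. Define $2\times2$ matrices of operators $$L_j(x)=\begin{pmatrix}\sigma_j^+\sigma_j^-+(x\ominus t_j)\,\sigma_j^-\sigma_j^+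 & (1+\beta (x\ominus t_j))\,\sigma_j^+\\ \sigma_j^- & \sigma_j^-\sigma_j^+\end{pmatrix},\qquad L'_j(x)=\begin{pmatrix}\sigma_j^-\sigma_j^++(x\oplus t_j)\,\sigma_j^+\sigma_j^- & \sigma_j^+\\ (1+\beta (x\oplus t_j))\,\sigma_j^- & \sigma_j^+\sigma_j^-\end{pmatrix},$$ $$\begin{pmatrix}A(x)&B(x)\\C(x)&D(x)\end{pmatrix}=L_N(x)\cdots L_1(x),\qquad \begin{pmatrix}A'(x)&B'(x)\\C'(x)&D'(x)\end{pmatrix}=L'_N(x)\cdots L'_1(x),$$ and the transfer matrices $H(x)=A(x)+qD(x)$ and $E(x)=A'(x)+qD'(x)$. With $|0\rangle=v_0^{\otimes N}$, $|N\rangle=v_1^{\otimes N}$ and their dual basis vectors $\langle 0|,\langle N|$, define for $y=(y_1,\dots,y_n)$ and $z=(z_1,\dots,z_k)$ the Bethe vectors $$|y\rangle=B(y_n)\cdots B(y_1)|0\rangle,\quad \langle y|=\langle 0|C(y_n)\cdots C(y_1),\quad |z\rangle=C'(z_k)\cdots C'(z_1)|N\rangle,\quad \langle z|=\langle N|B'(z_k)\cdots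 B'(z_1).$$ They are called on-shell if $y\in R[[q]]^n$, respectively $z\in R[[q]]^k$, has pairwise distinct entries, all $1+\beta y_i$, respectively all $1+\beta z_i$, are invertible in $R[[q]]$, and the Bethe ansatz equations hold: $$(-1)^n\frac{\prod_{l=1}^n(1+\beta y_l)}{(1+\beta y_i)^n}\prod_{j=1}^N (y_i\ominus t_j)+q=0\quad(1\le i\le n),$$ respectively $$(-1)^k\frac{\prod_{l=1}^k(1+\beta z_l)}{(1+\beta z_i)^k}\prod_{j=1}^N (z_i\oplus t_j)+q=0\quad(1\le i\le k).$$ \textbf{Theorem.} (1) Up to permutation of the entries there are exactly $\binom{N}{n}$ such solutions $y$ and exactly $\binom{N}{n}$ such solutions $z$. (2) For every such solution $y$, $|y\rangle$ and $\langle y|$ satisfy the right and left eigenvalue equations (over the field of fractions of $R[[q]][x]$) $$H(x)|y\rangle=\Lambda_y(x)|y\rangle,\quad \langle y|H(x)=\Lambda_y(x)\langle y|,\quad \Lambda_y(x)=\frac{\prod_{j=1}^N (x\ominus t_j)+(-1)^n q\prod_{i=1}^n\bigl(1+\beta (x\ominus y_i)\bigr)}{\prod_{i=1}^n (x\ominus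 y_i)},$$ and they are also a right and a left eigenvector of $E(x)$, for a common eigenvalue. (3) For every such solution $z$, $$E(x)|z\rangle=\Lambda'_z(x)|z\rangle,\quad \langle z|E(x)=\Lambda'_z(x)\langle z|,\quad \Lambda'_z(x)=\frac{\prod_{j=1}^N (x\oplus t_j)+(-1)^k q\prod_{i=1}^k\bigl(1+\beta (x\ominus z_i)\bigr)}{\prod_{i=1}^k (x\ominus z_i)},$$ and $|z\rangle,\langle z|$ are also a right and a left eigenvector of $H(x)$, for a common eigenvalue. (4) If $(y_\mu)_\mu$ is a family of $\binom{N}{n}$ such solutions, no two of which are permutations of each other, then the $|y_\mu\rangle$ form an $R[[q]]$-basis of $V_n^q$ and the $\langle y_\mu|$ form an $R[[q]]$-basis of $(V_n^q)^*$. The same holds for families $(z_\mu)_\mu$ and the vectors $|z_\mu\rangle$, $\langle z_\mu|$. -/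

import Mathlib

open Matrix

noncomputable section

namespace BetheAnsatz

/-! ### The multiplicative formal group law -/

/-- `x ⊕ y = x + y + β x y`. -/
def oplus {A : Type*} [CommRing A] (β x y : A) : A := x + y + β * x * y

/-- `x ⊖ y = (x - y) / (1 + β y)`; only used when `1 + β y` is invertible in `A`
(in a field, `Ring.inverse` is the usual inverse). -/
def ominus {A : Type*} [CommRing A] (β x y : A) : A := (x - y) * Ring.inverse (1 + β * y)

/-! ### Quantum space -/

/-- Binary strings of length `N`. They label the spin basis
`v_b = v_{b_1} ⊗ ⋯ ⊗ v_{b_N}` of `V^{⊗ N}`, where `V` is free on `v_0, v_1`. Vectors are given by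
their coordinates `Spin N → A` in this basis, dual vectors by their coordinates in the dual basis,
and operators by their matrices. -/
abbrev Spin (N : ℕ) : Type := Fin N → Fin 2

/-- The number of `1`-letters of a binary string. -/
def weight {N : ℕ} (b : Spin N) : ℕ := ∑ j, (b j : ℕ)

/-- Operators on the quantum space `A ⊗ V^{⊗ N}`. -/
abbrev Op (N : ℕ) (A : Type*) : Type _ := Matrix (Spin N) (Spin N) A

/-- The submodule `V_n` spanned by the basis vectors whose label has `n` letters `1`. -/
def weightSpace (N n : ℕ) (A : Type*) [CommRing A] : Submodule A (Spin N → A) :=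
  Submodule.span A {v | ∃ b : Spin N, weight b = n ∧ v = Pi.single b 1}

/-- `σ⁻ v_1 = v_0`, `σ⁻ v_0 = 0`. -/
def sigmaMinus (A : Type*) [CommRing A] : Matrix (Fin 2) (Fin 2) A := !![0, 1; 0, 0]

/-- `σ⁺ v_0 = v_1`, `σ⁺ v_1 = 0`. -/
def sigmaPlus (A : Type*) [CommRing A] : Matrix (Fin 2) (Fin 2) A := !![0, 0; 1, 0]

/-- The operator which acts by `m` on the `j`-th tensor factor and as the identity on the
others. -/
def site {N : ℕ} {A : Type*} [CommRing A] (j : Fin N) (m : Matrix (Fin 2) (Fin 2) A) : Op N A :=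
  Matrix.of fun b b' => if ∀ i, i ≠ j → b i = b' i then m (b j) (b' j) else 0

/-! ### `L`-operators, monodromy matrices, transfer matrices -/

/-- The operator `L(x|t_j)` acting on the auxiliary space and on the `j`-th factor of the quantum
space, as a `2 × 2` matrix over the auxiliary space with entries in the operators on the quantum
space. -/
def lax {N : ℕ} {A : Type*} [CommRing A] (β : A) (t : Fin N → A) (x : A) (j : Fin N) :
    Matrix (Fin 2) (Fin 2) (Op N A) :=
  !![site j (sigmaPlus A * sigmaMinus A + ominus β x (t j) • (sigmaMinus A * sigmaPlus A)),
     site j ((1 + β * ominus β x (t j)) • sigmaPlus A);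
     site j (sigmaMinus A),
     site j (sigmaMinus A * sigmaPlus A)]

/-- The operator `L'(x|t_j)`. -/
def lax' {N : ℕ} {A : Type*} [CommRing A] (β : A) (t : Fin N → A) (x : A) (j : Fin N) :
    Matrix (Fin 2) (Fin 2) (Op N A) :=
  !![site j (sigmaMinus A * sigmaPlus A + oplus β x (t j) • (sigmaPlus A * sigmaMinus A)),
     site j (sigmaPlus A);
     site j ((1 + β * oplus β x (t j)) • sigmaMinus A),
     site j (sigmaPlus A * sigmaMinus A)]

/-- The row monodromy matrix `M(x|t) = L(x|t_N) ⋯ L(x|t_1) = (A, B; C, D)`. -/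
def mono {N : ℕ} {A : Type*} [CommRing A] (β : A) (t : Fin N → A) (x : A) :
    Matrix (Fin 2) (Fin 2) (Op N A) :=
  (List.ofFn fun j => lax β t x j).reverse.prod

/-- The row monodromy matrix `M'(x|t) = L'(x|t_N) ⋯ L'(x|t_1) = (A', B'; C', D')`. -/
def mono' {N : ℕ} {A : Type*} [CommRing A] (β : A) (t : Fin N → A) (x : A) :
    Matrix (Fin 2) (Fin 2) (Op N A) :=
  (List.ofFn fun j => lax' β t x j).reverse.prod

/-- The transfer matrix `H(x|t) = A(x|t) + q D(x|t)`. -/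
def transferH {N : ℕ} {A : Type*} [CommRing A] (β q : A) (t : Fin N → A) (x : A) : Op N A :=
  mono β t x 0 0 + q • mono β t x 1 1

/-- The transfer matrix `E(x|t) = A'(x|t) + q D'(x|t)`. -/
def transferE {N : ℕ} {A : Type*} [CommRing A] (β q : A) (t : Fin N → A) (x : A) : Op N A :=
  mono' β t x 0 0 + q • mono' β t x 1 1

/-! ### Bethe vectors -/

/-- The Bethe vector `|y_1, …, y_m⟩ = B(y_m|t) ⋯ B(y_1|t) |0⟩`, `|0⟩ = v_0 ⊗ ⋯ ⊗ v_0`. -/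
def betheY {N m : ℕ} {A : Type*} [CommRing A] (β : A) (t : Fin N → A) (y : Fin m → A) :
    Spin N → A :=
  (List.ofFn fun i => mono β t (y i) 0 1).reverse.prod *ᵥ Pi.single (fun _ => 0) 1

/-- The dual Bethe vector `⟨y_1, …, y_m| = ⟨0| C(y_m|t) ⋯ C(y_1|t)`. -/
def dualBetheY {N m : ℕ} {A : Type*} [CommRing A] (β : A) (t : Fin N → A) (y : Fin m → A) :
    Spin N → A :=
  Pi.single (fun _ => 0) 1 ᵥ* (List.ofFn fun i => mono β t (y i) 1 0).reverse.prod

/-- The Bethe vector `|z_1, …, z_m⟩ = C'(z_m|t) ⋯ C'(z_1|t) |N⟩`, `|N⟩ = v_1 ⊗ ⋯ ⊗ v_1`. -/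
def betheZ {N m : ℕ} {A : Type*} [CommRing A] (β : A) (t : Fin N → A) (z : Fin m → A) :
    Spin N → A :=
  (List.ofFn fun i => mono' β t (z i) 1 0).reverse.prod *ᵥ Pi.single (fun _ => 1) 1

/-- The dual Bethe vector `⟨z_1, …, z_m| = ⟨N| B'(z_m|t) ⋯ B'(z_1|t)`. -/
def dualBetheZ {N m : ℕ} {A : Type*} [CommRing A] (β : A) (t : Fin N → A) (z : Fin m → A) :
    Spin N → A :=
  Pi.single (fun _ => 1) 1 ᵥ* (List.ofFn fun i => mono' β t (z i) 0 1).reverse.prod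

/-! ### Bethe ansatz equations -/

/-- `y = (y_1, …, y_m)` is a solution, with pairwise distinct entries, of the Bethe ansatz equations
`(-1)^m Π(y) / (1 + β y_i)^m ∏_j (y_i ⊖ t_j) + q = 0` for `i = 1, …, m`, where
`Π(y) = ∏_i (1 + β y_i)`. The denominators are required to be invertible. -/
def IsRootsY {N m : ℕ} {A : Type*} [CommRing A] (β q : A) (t : Fin N → A) (y : Fin m → A) :
    Prop :=
  Function.Injective y ∧ (∀ i, IsUnit (1 + β * y i)) ∧
    ∀ i, (-1) ^ m * (∏ l, (1 + β * y l)) * Ring.inverse (1 + β * y i) ^ m *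
      ∏ j, ominus β (y i) (t j) + q = 0

/-- `z = (z_1, …, z_m)` is a solution, with pairwise distinct entries, of the Bethe ansatz equations
`(-1)^m Π(z) / (1 + β z_i)^m ∏_j (z_i ⊕ t_j) + q = 0` for `i = 1, …, m`. -/
def IsRootsZ {N m : ℕ} {A : Type*} [CommRing A] (β q : A) (t : Fin N → A) (z : Fin m → A) :
    Prop :=
  Function.Injective z ∧ (∀ i, IsUnit (1 + β * z i)) ∧
    ∀ i, (-1) ^ m * (∏ l, (1 + β * z l)) * Ring.inverse (1 + β * z i) ^ m *
      ∏ j, oplus β (z i) (t j) + q = 0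

/-! ### Eigenvalues -/

/-- `(∏_j (x ⊖ t_j) + (-1)^m q ∏_i (1 + β (x ⊖ y_i))) / ∏_i (x ⊖ y_i)`. -/
def eigenvalueH {N m : ℕ} {F : Type*} [Field F] (β q : F) (t : Fin N → F) (x : F)
    (y : Fin m → F) : F :=
  (∏ j, ominus β x (t j) + (-1) ^ m * q * ∏ i, (1 + β * ominus β x (y i))) /
    ∏ i, ominus β x (y i)

/-- `(∏_j (x ⊕ t_j) + (-1)^m q ∏_i (1 + β (x ⊖ z_i))) / ∏_i (x ⊖ z_i)`. -/
def eigenvalueE {N m : ℕ} {F : Type*} [Field F] (β q : F) (t : Fin N → F) (x : F)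
    (z : Fin m → F) : F :=
  (∏ j, oplus β x (t j) + (-1) ^ m * q * ∏ i, (1 + β * ominus β x (z i))) /
    ∏ i, ominus β x (z i)

/-- `v` is a basis of the submodule `W`. -/
def IsBasisOf {ι A M : Type*} [CommRing A] [AddCommGroup M] [Module A M] (v : ι → M)
    (W : Submodule A M) : Prop :=
  LinearIndependent A v ∧ Submodule.span A (Set.range v) = W

/-! ### Coefficients: power series in `q`, and the spectral parameter `x` -/

/-- The field of fractions of `R⟦q⟧[x]`. -/
abbrev SpecField (R : Type*) [CommRing R] [IsDomain R] : Type _ :=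
  FractionRing (Polynomial (PowerSeries R))

/-- The spectral parameter `x`. -/
def specX (R : Type*) [CommRing R] [IsDomain R] : SpecField R :=
  algebraMap (Polynomial (PowerSeries R)) (SpecField R) Polynomial.X

/-- The inclusion of `R⟦q⟧` in the field of fractions of `R⟦q⟧[x]`. -/
def incl (R : Type*) [CommRing R] [IsDomain R] : PowerSeries R →+* SpecField R :=
  (algebraMap (Polynomial (PowerSeries R)) (SpecField R)).comp Polynomial.C

/-- Constant power series. -/
def const {R : Type*} [CommRing R] (a : R) : PowerSeries R := PowerSeries.C a

/-- `H(x|t)` with `x` and `q` indeterminates. -/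
def specH {R : Type*} [CommRing R] [IsDomain R] {N : ℕ} (β : R) (t : Fin N → R) :
    Op N (SpecField R) :=
  transferH (incl R (const β)) (incl R PowerSeries.X) (fun j => incl R (const (t j))) (specX R)

/-- `E(x|t)` with `x` and `q` indeterminates. -/
def specE {R : Type*} [CommRing R] [IsDomain R] {N : ℕ} (β : R) (t : Fin N → R) :
    Op N (SpecField R) :=
  transferE (incl R (const β)) (incl R PowerSeries.X) (fun j => incl R (const (t j))) (specX R)

/-- The vector `v` with entries in `R⟦q⟧`, with its entries regarded as elements of the field of
fractions of `R⟦q⟧[x]`. -/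
def extend {R : Type*} [CommRing R] [IsDomain R] {N : ℕ} (v : Spin N → PowerSeries R) :
    Spin N → SpecField R :=
  fun b => incl R (v b)

/-- `v` is a right eigenvector and `w` a left eigenvector of `T` for the eigenvalue `Λ`. (Both are
nonzero wherever they are members of a basis.) -/
def IsEigenpair {A : Type*} [CommRing A] {N : ℕ} (T : Op N A) (v w : Spin N → A) (Λ : A) : Prop :=
  T *ᵥ v = Λ • v ∧ w ᵥ* T = Λ • w

/-- The eigenvalue of `H(x|t)` for the power series `y_1, …, y_m`. -/
def onShellH {R : Type*} [CommRing R] [IsDomain R] {N m : ℕ} (β : R) (t : Fin N → R)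
    (y : Fin m → PowerSeries R) : SpecField R :=
  eigenvalueH (incl R (const β)) (incl R PowerSeries.X) (fun j => incl R (const (t j))) (specX R)
    (fun i => incl R (y i))

/-- The eigenvalue of `E(x|t)` for the power series `z_1, …, z_m`. -/
def onShellE {R : Type*} [CommRing R] [IsDomain R] {N m : ℕ} (β : R) (t : Fin N → R)
    (z : Fin m → PowerSeries R) : SpecField R :=
  eigenvalueE (incl R (const β)) (incl R PowerSeries.X) (fun j => incl R (const (t j))) (specX R)
    (fun i => incl R (z i))

end BetheAnsatz

end

noncomputable section

open scoped Kronecker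

namespace BetheAnsatz

/-! ### Matrix elements of the monodromy matrices -/

section

variable {A : Type*} [CommRing A] {N : ℕ}

/-! The argument is the algebraic Bethe ansatz, completed by perturbation in `q` around `q = 0`.

Entries of the monodromy matrices are matrix products (`mpo`), so exchange relations follow from
finite checks on one site. From `rtt_cell` come the commutation rules of A, B and D. Moving A and D
through a string of B's (`offShell_expansion`) turns `H(x)|y⟩` into a multiple of `|y⟩` plus
unwanted vectors, whose coefficients are multiples of the left sides of the Bethe equations
(`transferH_mulVec_betheY`).

At `q = 0` the Bethe equations force each `y_i` to be some `t_j`. Writing `y_i = t_{f i} + q w_i`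
turns them into a fixed point equation for a `q`-adic contraction, so every injective `f` lifts to
exactly one solution. Solutions up to permutation therefore correspond to `n`-element sets of sites
(`ncard_bethe_solutions`).

For completeness, the Bethe vectors with roots among the `t_j` already span the weight space over
`R` (`weightSpace_le_betheSpan`, by induction on the number of sites). Hence the coordinate
determinant of an on-shell family has invertible constant term and is a unit in `R⟦q⟧`
(`isUnit_coordMatrix`).

Two symmetries give the rest. Transposition, up to a diagonal gauge, reverses the order of the sites
and exchanges B with C, which yields the dual vectors (`mono_transpose`). Particle-hole duality with
`t_j ↦ ⊖ t_j` exchanges H with E and `y` with `z` (`mono'_eq_mono`).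

That `|y⟩` is also an eigenvector of E needs no second Bethe ansatz: H and E commute
(`transfer_commute`) and H has simple spectrum on the weight space, because its eigenvalues at `q =
0` already determine the set of roots (`range_subset_of_eigenvalueH_eq`,
`exists_common_eigenvalue`). -/

/-- The matrix product operator with local tensors `ℓ j s s'`, acting on an auxiliary space with
basis `I`. -/
def mpo {I : Type*} [Fintype I] [DecidableEq I] (ℓ : Fin N → Fin 2 → Fin 2 → Matrix I I A)
    (b b' : Spin N) : Matrix I I A :=
  (List.ofFn fun j => ℓ j (b j) (b' j)).reverse.prod

theorem sum_site_mul (j : Fin N) (m : Matrix (Fin 2) (Fin 2) A) (b : Spin N) (v : Spin N → A) :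
    ∑ b', site j m b b' * v b' = ∑ s, m (b j) s * v (Function.update b j s) := by
  have hinj : Function.Injective fun s : Fin 2 => Function.update b j s :=
    Function.update_injective b j
  calc ∑ b', site j m b b' * v b'
      = ∑ b' ∈ Finset.univ.image (fun s : Fin 2 => Function.update b j s),
          m (b j) (b' j) * v b' := by
        rw [← Finset.sum_subset (Finset.subset_univ
          (Finset.univ.image (fun s : Fin 2 => Function.update b j s)))]
        · refine Finset.sum_congr rfl fun b' hb' => ?_
          obtain ⟨s, -, rfl⟩ := Finset.mem_image.1 hb'
          have : ∀ i, i ≠ j → b i = Function.update b j s i := fun i hi => by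
            rw [Function.update_of_ne hi]
          simp only [site, Matrix.of_apply]
          rw [if_pos this]
        · intro b' _ hb'
          have : ¬ ∀ i, i ≠ j → b i = b' i := fun h => hb' (Finset.mem_image.2
            ⟨b' j, Finset.mem_univ _, (Function.eq_update_iff.2
              ⟨rfl, fun i hi => (h i hi).symm⟩).symm⟩)
          simp only [site, Matrix.of_apply]
          rw [if_neg this, zero_mul]
    _ = _ := by
        rw [Finset.sum_image hinj.injOn]
        simp

/-- Factors at distinct sites change different letters, so all intermediate strings are forced and
only the sum over auxiliary indices survives. Without `Nodup`, a site could be changed twice and a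
sum over letters would remain. -/
theorem prod_map_site_apply (ℓ : Fin N → Fin 2 → Fin 2 → Matrix (Fin 2) (Fin 2) A)
    (js : List (Fin N)) (hjs : js.Nodup) (a c : Fin 2) (b b' : Spin N) :
    (js.map fun j => Matrix.of fun a c => site j (Matrix.of fun s s' => ℓ j s s' a c)).prod
      a c b b' =
      if ∀ i ∉ js, b i = b' i then (js.map fun j => ℓ j (b j) (b' j)).prod a c else 0 := by
  induction js generalizing a b with
  | nil =>
    by_cases h : b = b'
    · subst h
      simp [Matrix.one_apply]
      split_ifs <;> simp
    · have : ¬ ∀ i, b i = b' i := fun h' => h (funext h')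
      simp [this, Matrix.one_apply]
      split_ifs <;> simp [h]
  | cons j js ih =>
    obtain ⟨hj, hjs⟩ := List.nodup_cons.1 hjs
    -- The tail of the list does not touch site `j`, so the letter `s` left there by the head must
    -- already be `b' j`.
    have key : ∀ e s, (if ∀ i ∉ js, Function.update b j s i = b' i then
        (js.map fun i => ℓ i (Function.update b j s i) (b' i)).prod e c else 0) =
        if s = b' j ∧ ∀ i ∉ j :: js, b i = b' i then
          (js.map fun i => ℓ i (b i) (b' i)).prod e c else 0 := by
      intro e s
      have h1 : (js.map fun i => ℓ i (Function.update b j s i) (b' i)) =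
          js.map fun i => ℓ i (b i) (b' i) := by
        refine List.map_congr_left fun i hi => ?_
        rw [Function.update_of_ne]
        rintro rfl
        exact hj hi
      rw [h1]
      refine if_congr ⟨fun h => ⟨?_, fun i hi => ?_⟩, fun h i hi => ?_⟩ rfl rfl
      · simpa using h j hj
      · simp only [List.mem_cons, not_or] at hi
        simpa [hi.1] using h i hi.2
      · by_cases hij : i = j
        · subst hij
          simpa using h.1
        · simpa [hij] using h.2 i (by simp [hij, hi])
    simp only [List.map_cons, List.prod_cons, Matrix.mul_apply, Matrix.sum_apply, Matrix.of_apply,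
      sum_site_mul, ih hjs, key]
    by_cases h : ∀ i ∉ j :: js, b i = b' i
    · simp only [eq_true h, and_true, mul_ite, mul_zero, Finset.sum_ite_eq', Finset.mem_univ, if_true]
    · simp only [h, and_false, if_false, mul_zero, Finset.sum_const_zero]

theorem prod_ofFn_site_apply (ℓ : Fin N → Fin 2 → Fin 2 → Matrix (Fin 2) (Fin 2) A)
    (a c : Fin 2) (b b' : Spin N) :
    (List.ofFn fun j => Matrix.of fun a c => site j (Matrix.of fun s s' => ℓ j s s' a c)).reverse.prod
      a c b b' = mpo ℓ b b' a c := by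
  have h := prod_map_site_apply ℓ (List.finRange N).reverse
    (List.nodup_reverse.2 (List.nodup_finRange N)) a c b b'
  simp only [List.mem_reverse, List.mem_finRange, not_true, IsEmpty.forall_iff, implies_true,
    if_true, List.map_reverse, ← List.ofFn_eq_map] at h
  exact h

/-- The local tensors of the operators `L`, as a function of `u = x ⊖ t_j`. -/
def cell (β u : A) : Fin 2 → Fin 2 → Matrix (Fin 2) (Fin 2) A :=
  ![![!![u, 0; 0, 1], !![0, 0; 1, 0]], ![!![0, 1 + β * u; 0, 0], !![1, 0; 0, 0]]]

/-- The local tensors of the operators `L'`, as a function of `u = x ⊕ t_j`. -/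
def cell' (β u : A) : Fin 2 → Fin 2 → Matrix (Fin 2) (Fin 2) A :=
  ![![!![1, 0; 0, 0], !![0, 0; 1 + β * u, 0]], ![!![0, 1; 0, 0], !![u, 0; 0, 1]]]

theorem lax_eq (β : A) (t : Fin N → A) (x : A) (j : Fin N) :
    lax β t x j = Matrix.of fun a c =>
      site j (Matrix.of fun s s' => cell β (ominus β x (t j)) s s' a c) := by
  refine Matrix.ext fun a c => ?_
  fin_cases a <;> fin_cases c <;>
  · simp only [lax, Matrix.of_apply]
    refine congrArg (site j) (Matrix.ext fun s s' => ?_)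
    fin_cases s <;> fin_cases s' <;> simp [cell, sigmaMinus, sigmaPlus]

theorem lax'_eq (β : A) (t : Fin N → A) (x : A) (j : Fin N) :
    lax' β t x j = Matrix.of fun a c =>
      site j (Matrix.of fun s s' => cell' β (oplus β x (t j)) s s' a c) := by
  refine Matrix.ext fun a c => ?_
  fin_cases a <;> fin_cases c <;>
  · simp only [lax', Matrix.of_apply]
    refine congrArg (site j) (Matrix.ext fun s s' => ?_)
    fin_cases s <;> fin_cases s' <;> simp [cell', sigmaMinus, sigmaPlus]

theorem mono_apply (β : A) (t : Fin N → A) (x : A) (a c : Fin 2) (b b' : Spin N) :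
    mono β t x a c b b' = mpo (fun j => cell β (ominus β x (t j))) b b' a c := by
  rw [← prod_ofFn_site_apply]
  simp only [mono, lax_eq]

theorem mono'_apply (β : A) (t : Fin N → A) (x : A) (a c : Fin 2) (b b' : Spin N) :
    mono' β t x a c b b' = mpo (fun j => cell' β (oplus β x (t j))) b b' a c := by
  rw [← prod_ofFn_site_apply]
  simp only [mono', lax'_eq]

/-! ### Matrix product operators -/

section MPO

variable {I J : Type*} [Fintype I] [DecidableEq I] [Fintype J] [DecidableEq J]

theorem mpo_zero (ℓ : Fin 0 → Fin 2 → Fin 2 → Matrix I I A) (b b' : Spin 0) :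
    mpo ℓ b b' = 1 := by
  simp [mpo]

theorem mpo_succ (ℓ : Fin (N + 1) → Fin 2 → Fin 2 → Matrix I I A) (b b' : Spin (N + 1)) :
    mpo ℓ b b' = mpo (fun j => ℓ j.succ) (Fin.tail b) (Fin.tail b') * ℓ 0 (b 0) (b' 0) := by
  simp [mpo, List.ofFn_succ, Fin.tail]

theorem sum_spin_succ {M : Type*} [AddCommMonoid M] (f : Spin (N + 1) → M) :
    ∑ b, f b = ∑ s, ∑ b : Spin N, f (Fin.cons s b) := by
  rw [← (Fin.consEquiv fun _ : Fin (N + 1) => Fin 2).sum_comp, Fintype.sum_prod_type]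
  rfl

/-- Composition on the quantum space can be carried out site by site, at the price of tensoring the
auxiliary spaces. The primed version is the opposite order of composition with the same order of
auxiliary factors. -/
theorem sum_mpo_kronecker_mpo (ℓ : Fin N → Fin 2 → Fin 2 → Matrix I I A)
    (ℓ' : Fin N → Fin 2 → Fin 2 → Matrix J J A) (b b' : Spin N) :
    ∑ b'', (mpo ℓ b b'') ⊗ₖ (mpo ℓ' b'' b') =
      mpo (fun j s s' => ∑ s'', (ℓ j s s'') ⊗ₖ (ℓ' j s'' s')) b b' := by
  induction N with
  | zero => simp [mpo_zero]
  | succ N ih =>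
    rw [sum_spin_succ, mpo_succ, ← ih, Finset.sum_mul_sum, Finset.sum_comm]
    simp only [mpo_succ, Fin.tail_cons, Fin.cons_zero, mul_kronecker_mul]

theorem sum_mpo_kronecker_mpo' (ℓ : Fin N → Fin 2 → Fin 2 → Matrix I I A)
    (ℓ' : Fin N → Fin 2 → Fin 2 → Matrix J J A) (b b' : Spin N) :
    ∑ b'', (mpo ℓ b'' b') ⊗ₖ (mpo ℓ' b b'') =
      mpo (fun j s s' => ∑ s'', (ℓ j s'' s') ⊗ₖ (ℓ' j s s'')) b b' := by
  induction N with
  | zero => simp [mpo_zero]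
  | succ N ih =>
    rw [sum_spin_succ, mpo_succ, ← ih, Finset.sum_mul_sum, Finset.sum_comm]
    simp only [mpo_succ, Fin.tail_cons, Fin.cons_zero, mul_kronecker_mul]

/-- The railway argument: a local intertwiner is pulled through the chain one site at a time. -/
theorem mul_mpo_eq_mpo_mul (R : Matrix I I A) (ℓ ℓ' : Fin N → Fin 2 → Fin 2 → Matrix I I A)
    (h : ∀ j s s', R * ℓ j s s' = ℓ' j s s' * R) (b b' : Spin N) :
    R * mpo ℓ b b' = mpo ℓ' b b' * R := by
  induction N with
  | zero => simp [mpo_zero]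
  | succ N ih =>
    rw [mpo_succ, mpo_succ, ← mul_assoc, ih _ _ fun j => h j.succ, mul_assoc, h, mul_assoc]

theorem reverse_ofFn {α : Type*} (f : Fin N → α) :
    (List.ofFn f).reverse = List.ofFn fun j => f j.rev := by
  refine List.ext_getElem (by simp) fun i h₁ h₂ => ?_
  simp only [List.getElem_reverse, List.getElem_ofFn, List.length_ofFn]
  congr 1
  ext
  simp [Fin.val_rev]
  omega

/-- Transposition of the auxiliary space reverses the order of the sites. -/
theorem mpo_rev (ℓ : Fin N → Fin 2 → Fin 2 → Matrix I I A) (b b' : Spin N) :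
    mpo (fun j s s' => (ℓ j.rev s s')ᵀ) (b ∘ Fin.rev) (b' ∘ Fin.rev) = (mpo ℓ b b')ᵀ := by
  rw [mpo, mpo, Matrix.transpose_list_prod, List.map_reverse, List.reverse_reverse, List.map_ofFn,
    reverse_ofFn]
  simp [Function.comp_def]

end MPO

end

section

variable {A : Type*} [CommRing A] {N : ℕ}

/-! ### Exchange relations -/

/-- A matrix of six-vertex shape on the tensor product of two auxiliary spaces. -/
def sixVertex (r₀ a b c d r₁ : A) : Matrix (Fin 2 × Fin 2) (Fin 2 × Fin 2) A :=
  Matrix.of fun p p' => ![![![![r₀, 0], ![0, 0]], ![![0, a], ![b, 0]]],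
    ![![![0, c], ![d, 0]], ![![0, 0], ![0, r₁]]]] p.1 p.2 p'.1 p'.2

theorem oplus_ominus (β x t : A) (h : IsUnit (1 + β * t)) :
    x = ominus β x t + t + β * ominus β x t * t := by
  have := Ring.inverse_mul_cancel _ h
  rw [ominus]
  linear_combination -(x - t) * this

/-- A finite polynomial check. Expressing `x` and `y` through `u = x ⊖ t` and `v = y ⊖ t` avoids all
denominators. -/
theorem rtt_cell (β t u v : A) (s s' : Fin 2) (x y : A) (hx : x = u + t + β * u * t)
    (hy : y = v + t + β * v * t) :
    sixVertex (1 + β * x) 0 (1 + β * x) (1 + β * y) (y - x) (1 + β * x) *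
        ∑ s'', cell β u s s'' ⊗ₖ cell β v s'' s' =
      (∑ s'', cell β u s'' s' ⊗ₖ cell β v s s'') *
        sixVertex (1 + β * x) 0 (1 + β * x) (1 + β * y) (y - x) (1 + β * x) := by
  subst hx hy
  ext ⟨a, b⟩ ⟨c, d⟩
  revert s s' a b c d
  simp [Fin.forall_fin_two, Matrix.mul_apply, Fintype.sum_prod_type, cell, sixVertex]
  ring_nf
  simp only [and_self]

/-- This intertwiner is singular: it kills the basis vector `(1, 1)`. It therefore does not by
itself make the traces commute, and `mixed_cell_left` supplies the missing relation. -/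
theorem mixed_cell (β t v s₀ : A) (s s' : Fin 2) (y x : A) (hy : y = v + t + β * v * t)
    (hs : s₀ = x + t + β * x * t) :
    sixVertex (oplus β y x) 1 (1 + β * oplus β y x) 1 1 0 *
        ∑ s'', cell β v s s'' ⊗ₖ cell' β s₀ s'' s' =
      (∑ s'', cell β v s'' s' ⊗ₖ cell' β s₀ s s'') *
        sixVertex (oplus β y x) 1 (1 + β * oplus β y x) 1 1 0 := by
  subst hy hs
  ext ⟨a, b⟩ ⟨c, d⟩
  revert s s' a b c d
  simp [Fin.forall_fin_two, Matrix.mul_apply, Fintype.sum_prod_type, cell, cell', sixVertex, oplus]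
  ring_nf
  simp only [and_self]

/-- The middle block is the adjugate of the one in `mixed_cell`, and the two intertwiners multiply
to `-β (y ⊕ x)` times the projection `sixVertex 1 1 0 0 1 0`. This is the relation for the inverse
intertwiner, in a division-free form that remains meaningful at `β = 0`. -/
theorem mixed_cell_left (β t v s₀ : A) (s s' : Fin 2) (y x : A) (hy : y = v + t + β * v * t)
    (hs : s₀ = x + t + β * x * t) :
    sixVertex (-β) 1 (-(1 + β * oplus β y x)) (-1) 1 0 *
        ((∑ s'', cell β v s'' s' ⊗ₖ cell' β s₀ s s'') * sixVertex 1 1 0 0 1 0) =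
      sixVertex 1 1 0 0 1 0 * ((∑ s'', cell β v s s'' ⊗ₖ cell' β s₀ s'' s') *
        sixVertex (-β) 1 (-(1 + β * oplus β y x)) (-1) 1 0) := by
  subst hy hs
  ext ⟨a, b⟩ ⟨c, d⟩
  revert s s' a b c d
  simp [Fin.forall_fin_two, Matrix.mul_apply, Fintype.sum_prod_type, cell, cell', sixVertex, oplus]
  ring_nf
  simp only [and_self]

theorem cell_kronecker_mul_proj (β v s₀ : A) (s s' : Fin 2) :
    (∑ s'', cell β v s s'' ⊗ₖ cell' β s₀ s'' s') * sixVertex 1 1 0 0 1 0 =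
      ∑ s'', cell β v s s'' ⊗ₖ cell' β s₀ s'' s' := by
  ext ⟨a, b⟩ ⟨c, d⟩
  revert s s' a b c d
  simp [Fin.forall_fin_two, Matrix.mul_apply, Fintype.sum_prod_type, cell, cell', sixVertex]

theorem proj_mul_cell_kronecker (β v s₀ : A) (s s' : Fin 2) :
    sixVertex 1 1 0 0 1 0 * (∑ s'', cell β v s'' s' ⊗ₖ cell' β s₀ s s'') =
      ∑ s'', cell β v s'' s' ⊗ₖ cell' β s₀ s s'' := by
  ext ⟨a, b⟩ ⟨c, d⟩
  revert s s' a b c d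
  simp [Fin.forall_fin_two, Matrix.mul_apply, Fintype.sum_prod_type, cell, cell', sixVertex]

end

section

variable {A : Type*} [CommRing A] {N : ℕ}

theorem mul_apply_eq_mpo {M M' : Matrix (Fin 2) (Fin 2) (Op N A)}
    {ℓ ℓ' : Fin N → Fin 2 → Fin 2 → Matrix (Fin 2) (Fin 2) A}
    (hM : ∀ a c b b', M a c b b' = mpo ℓ b b' a c)
    (hM' : ∀ a c b b', M' a c b b' = mpo ℓ' b b' a c) (a a' c c' : Fin 2) (b b' : Spin N) :
    (M a c * M' a' c') b b' =
      mpo (fun j s s' => ∑ s'', ℓ j s s'' ⊗ₖ ℓ' j s'' s') b b' (a, a') (c, c') := by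
  simp only [← sum_mpo_kronecker_mpo, Matrix.mul_apply, Matrix.sum_apply, hM, hM',
    kroneckerMap_apply]

theorem mul_apply_eq_mpo' {M M' : Matrix (Fin 2) (Fin 2) (Op N A)}
    {ℓ ℓ' : Fin N → Fin 2 → Fin 2 → Matrix (Fin 2) (Fin 2) A}
    (hM : ∀ a c b b', M a c b b' = mpo ℓ b b' a c)
    (hM' : ∀ a c b b', M' a c b b' = mpo ℓ' b b' a c) (a a' c c' : Fin 2) (b b' : Spin N) :
    (M' a' c' * M a c) b b' =
      mpo (fun j s s' => ∑ s'', ℓ j s'' s' ⊗ₖ ℓ' j s s'') b b' (a, a') (c, c') := by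
  simp only [← sum_mpo_kronecker_mpo', Matrix.mul_apply, Matrix.sum_apply, hM, hM',
    kroneckerMap_apply, mul_comm]

theorem proj_mul_proj :
    sixVertex 1 1 0 0 1 0 * sixVertex 1 1 0 0 1 0 = (sixVertex 1 1 0 0 1 0 : Matrix _ _ A) := by
  ext ⟨a, b⟩ ⟨c, d⟩
  revert a b c d
  simp [Fin.forall_fin_two, Matrix.mul_apply, Fintype.sum_prod_type, sixVertex]

theorem mul_proj_apply (X : Matrix (Fin 2 × Fin 2) (Fin 2 × Fin 2) A) (p : Fin 2 × Fin 2) :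
    (X * sixVertex 1 1 0 0 1 0 : Matrix _ _ A) p (1, 1) = 0 := by
  simp [Matrix.mul_apply, Fintype.sum_prod_type, sixVertex]

theorem proj_mul_apply (X : Matrix (Fin 2 × Fin 2) (Fin 2 × Fin 2) A) (p : Fin 2 × Fin 2) :
    (sixVertex 1 1 0 0 1 0 * X : Matrix _ _ A) (1, 1) p = 0 := by
  simp [Matrix.mul_apply, Fintype.sum_prod_type, sixVertex]

/-- The railway argument for an intertwiner that works only modulo a projection `P`. The two
absorption rules allow `P` to be inserted between neighbouring sites; the second conclusion carries
`P` through the induction. -/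
theorem mpo_intertwine {I : Type*} [Fintype I] [DecidableEq I] {P S : Matrix I I A}
    {ℓ ℓ' : Fin N → Fin 2 → Fin 2 → Matrix I I A} (hP : P * P = P) (hS : S * P = P * S)
    (hℓ : ∀ j s s', ℓ j s s' * P = ℓ j s s') (hℓ' : ∀ j s s', P * ℓ' j s s' = ℓ' j s s')
    (h : ∀ j s s', S * (ℓ' j s s' * P) = P * (ℓ j s s' * S)) (b b' : Spin N) :
    S * (mpo ℓ' b b' * P) = P * (mpo ℓ b b' * S) ∧ P * mpo ℓ b b' * P = P * mpo ℓ b b' := by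
  induction N with
  | zero => simp [mpo_zero, hP, hS]
  | succ N ih =>
    obtain ⟨h₁, h₂⟩ := ih (fun j => hℓ j.succ) (fun j => hℓ' j.succ) (fun j => h j.succ)
      (Fin.tail b) (Fin.tail b')
    rw [mpo_succ, mpo_succ]
    refine ⟨?_, by rw [mul_assoc, mul_assoc, hℓ]⟩
    set W := mpo (fun j => ℓ j.succ) (Fin.tail b) (Fin.tail b')
    set W' := mpo (fun j => ℓ' j.succ) (Fin.tail b) (Fin.tail b')
    calc S * (W' * ℓ' 0 (b 0) (b' 0) * P) = S * (W' * P) * (ℓ' 0 (b 0) (b' 0) * P) := by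
          conv_lhs => rw [← hℓ']
          simp only [mul_assoc]
      _ = P * W * (S * (ℓ' 0 (b 0) (b' 0) * P)) := by rw [h₁]; simp only [mul_assoc]
      _ = P * W * P * (ℓ 0 (b 0) (b' 0) * S) := by rw [h]; simp only [mul_assoc]
      _ = _ := by rw [h₂]; simp only [mul_assoc]

/-! ### Commutation relations of the monodromy entries and of the transfer matrices -/

section RTT

variable {β : A} {t : Fin N → A}

theorem rtt (ht : ∀ j, IsUnit (1 + β * t j)) (x y : A) (p p' : Fin 2 × Fin 2) :
    ∑ r, sixVertex (1 + β * x) 0 (1 + β * x) (1 + β * y) (y - x) (1 + β * x) p r •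
        (mono β t x r.1 p'.1 * mono β t y r.2 p'.2) =
      ∑ r, sixVertex (1 + β * x) 0 (1 + β * x) (1 + β * y) (y - x) (1 + β * x) r p' •
        (mono β t y p.2 r.2 * mono β t x p.1 r.1) := by
  ext b b'
  have h := congrFun (congrFun (mul_mpo_eq_mpo_mul _ _ _ (fun j s s' =>
    rtt_cell β (t j) (ominus β x (t j)) (ominus β y (t j)) s s' x y
      (oplus_ominus β x _ (ht j)) (oplus_ominus β y _ (ht j))) b b') p) p'
  simp only [Matrix.mul_apply (M := sixVertex _ _ _ _ _ _), 
    Matrix.mul_apply (N := sixVertex _ _ _ _ _ _)] at h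
  simp only [Matrix.sum_apply, Matrix.smul_apply, smul_eq_mul,
    mul_apply_eq_mpo (mono_apply β t x) (mono_apply β t y),
    mul_apply_eq_mpo' (mono_apply β t x) (mono_apply β t y)]
  rw [h]
  exact Finset.sum_congr rfl fun r _ => mul_comm _ _

theorem mono_A_mul_B (ht : ∀ j, IsUnit (1 + β * t j)) (x y : A) :
    (x - y) • (mono β t x 0 0 * mono β t y 0 1) =
      (1 + β * y) • (mono β t y 0 1 * mono β t x 0 0) -
        (1 + β * y) • (mono β t x 0 1 * mono β t y 0 0) := by
  have h := rtt ht y x (0, 0) (1, 0)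
  simp [Fintype.sum_prod_type, sixVertex] at h
  rw [h]
  abel

theorem mono_D_mul_B (ht : ∀ j, IsUnit (1 + β * t j)) (x y : A) :
    (x - y) • (mono β t x 1 1 * mono β t y 0 1) =
      (1 + β * y) • (mono β t x 0 1 * mono β t y 1 1) -
        (1 + β * x) • (mono β t y 0 1 * mono β t x 1 1) := by
  have h := rtt ht x y (1, 0) (1, 1)
  simp [Fintype.sum_prod_type, sixVertex] at h
  rw [← h, ← neg_sub y x, neg_smul]
  abel

theorem mono_B_commute (ht : ∀ j, IsUnit (1 + β * t j)) (x y : A) (hx : IsUnit (1 + β * x)) :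
    Commute (mono β t x 0 1) (mono β t y 0 1) := by
  have h := rtt ht x y (0, 0) (1, 1)
  simp [Fintype.sum_prod_type, sixVertex] at h
  exact hx.smul_left_cancel.1 h

/-- The corner entry of the mixed exchange relation is the commutation relation multiplied by `y ⊕
x`, which has to be cancelled. -/
theorem mixed_A_commute (ht : ∀ j, IsUnit (1 + β * t j)) (x y : A) (hp : IsUnit (oplus β y x)) :
    Commute (mono β t y 0 0) (mono' β t x 0 0) := by
  refine hp.smul_left_cancel.1 ?_
  ext b b'
  have h := congrFun (congrFun (mul_mpo_eq_mpo_mul _ _ _ (fun j s s' =>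
    mixed_cell β (t j) (ominus β y (t j)) (oplus β x (t j)) s s' y x
      (oplus_ominus β y _ (ht j)) rfl) b b') (0, 0)) (0, 0)
  simp only [Matrix.smul_apply, smul_eq_mul,
    mul_apply_eq_mpo (mono_apply β t y) (mono'_apply β t x),
    mul_apply_eq_mpo' (mono_apply β t y) (mono'_apply β t x)]
  simpa [Matrix.mul_apply, Fintype.sum_prod_type, sixVertex, mul_comm] using h

/-- The entries `((1, 0), (0, 1))` of the two intertwining relations both contain the off-diagonal
products `C B'` and `B' C`, with signs such that these cancel when the relations are added. -/
theorem mixed_AD (ht : ∀ j, IsUnit (1 + β * t j)) (x y : A) :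
    mono β t y 0 0 * mono' β t x 1 1 + mono β t y 1 1 * mono' β t x 0 0 =
      mono' β t x 1 1 * mono β t y 0 0 + mono' β t x 0 0 * mono β t y 1 1 := by
  ext b b'
  have h := congrFun (congrFun (mul_mpo_eq_mpo_mul _ _ _ (fun j s s' =>
    mixed_cell β (t j) (ominus β y (t j)) (oplus β x (t j)) s s' y x
      (oplus_ominus β y _ (ht j)) rfl) b b') (1, 0)) (0, 1)
  set ℓ := fun (j : Fin N) s s' =>
    ∑ s'', cell β (ominus β y (t j)) s s'' ⊗ₖ cell' β (oplus β x (t j)) s'' s' with hℓ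
  set ℓ' := fun (j : Fin N) s s' =>
    ∑ s'', cell β (ominus β y (t j)) s'' s' ⊗ₖ cell' β (oplus β x (t j)) s s'' with hℓ'
  have h' : sixVertex (-β) 1 (-(1 + β * oplus β y x)) (-1) 1 0 *
      (mpo ℓ' b b' * sixVertex 1 1 0 0 1 0) = sixVertex 1 1 0 0 1 0 * (mpo ℓ b b' *
        sixVertex (-β) 1 (-(1 + β * oplus β y x)) (-1) 1 0) := by
    refine (mpo_intertwine proj_mul_proj ?_ (fun _ => cell_kronecker_mul_proj _ _ _)
      (fun _ => proj_mul_cell_kronecker _ _ _) (fun j s s' => 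
        mixed_cell_left β (t j) (ominus β y (t j)) (oplus β x (t j)) s s' y x
          (oplus_ominus β y _ (ht j)) rfl) b b').1
    ext ⟨a, b⟩ ⟨c, d⟩
    revert a b c d
    simp [Fin.forall_fin_two, Matrix.mul_apply, Fintype.sum_prod_type, sixVertex]
  have h' := congrFun (congrFun h' (1, 0)) (0, 1)
  simp only [Matrix.add_apply,
    mul_apply_eq_mpo (mono_apply β t y) (mono'_apply β t x),
    mul_apply_eq_mpo' (mono_apply β t y) (mono'_apply β t x), ← hℓ, ← hℓ']
  simp [Matrix.mul_apply, Fintype.sum_prod_type, sixVertex] at h h'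
  linear_combination h + h'

/-- For `N ≥ 1` both products vanish: the local tensors of one order have zero `(1, 1)` column,
those of the other order zero `(1, 1)` row. For `N = 0` both are the identity. -/
theorem mixed_D_commute (x y : A) : Commute (mono β t y 1 1) (mono' β t x 1 1) := by
  ext b b'
  rw [mul_apply_eq_mpo (mono_apply β t y) (mono'_apply β t x),
    mul_apply_eq_mpo' (mono_apply β t y) (mono'_apply β t x)]
  cases N with
  | zero => simp [mpo_zero]
  | succ N =>
    trans 0
    · rw [mpo_succ, ← cell_kronecker_mul_proj, ← mul_assoc]
      exact mul_proj_apply _ _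
    · rw [mpo, List.ofFn_succ', List.concat_eq_append, List.reverse_append, List.reverse_singleton,
        List.singleton_append, List.prod_cons, ← proj_mul_cell_kronecker, mul_assoc]
      exact (proj_mul_apply _ _).symm

/-- The coefficients of `1`, `q` and `q ^ 2` are exactly the three preceding relations. -/
theorem transfer_commute (ht : ∀ j, IsUnit (1 + β * t j)) (x y : A) (q : A) (hp : IsUnit (oplus β y x)) :
    Commute (transferH β q t y) (transferE β q t x) := by
  have h1 := (mixed_A_commute ht x y hp).eq
  have h2 := mixed_AD ht x y
  have h3 := (mixed_D_commute (β := β) (t := t) x y).eq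
  rw [Commute, SemiconjBy, transferH, transferE]
  simp only [add_mul, mul_add, smul_mul_assoc, mul_smul_comm, h1, h3]
  have h4 := congrArg (q • ·) h2
  simp only [smul_add] at h4
  linear_combination (norm := module) h4

end RTT

end

section

/-! ### Off-shell action on Bethe vectors -/

/-- Induction on the set of roots. Pulling `X x` past the new `B (y n)` produces each older unwanted
vector twice, once directly and once through `X (y n)`; `hfg` is the identity that merges the two
coefficients into one. The abstract form serves both A and D. -/
theorem offShell_expansion {K V ι : Type*} [Field K] [AddCommGroup V] [Module K V] [DecidableEq ι]
    {good : K → Prop} {X B : K → Module.End K V} {f g : K → K → K} {α : K → K} {y : ι → K}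
    {Ψ : Finset ι → V}
    (hXB : ∀ z w, z ≠ w → good z → good w → ∀ v,
      X z (B w v) = f z w • B w (X z v) + g z w • B z (X w v))
    (hBB : ∀ z w, good z → good w → ∀ v, B z (B w v) = B w (B z v))
    (hfg : ∀ x y z, x ≠ y → x ≠ z → y ≠ z →
      f x z * g x y + g x z * g z y = g x y * f y z)
    (h₀ : ∀ z, X z (Ψ ∅) = α z • Ψ ∅)
    (hΨ : ∀ i S, i ∉ S → Ψ (insert i S) = B (y i) (Ψ S))
    (hy : Function.Injective y) (hgood : ∀ i, good (y i)) (S : Finset ι) (x : K) (hx : good x)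
    (hxy : ∀ i ∈ S, x ≠ y i) :
    X x (Ψ S) = (α x * ∏ i ∈ S, f x (y i)) • Ψ S +
      ∑ i ∈ S, (g x (y i) * (α (y i) * ∏ l ∈ S.erase i, f (y i) (y l))) • B x (Ψ (S.erase i)) := by
  induction S using Finset.induction_on generalizing x with
  | empty => simp [h₀]
  | insert n S hn ih =>
    have hne : ∀ i ∈ S, y n ≠ y i := fun i hi h => hn (hy h ▸ hi)
    have hxn : x ≠ y n := hxy n (Finset.mem_insert_self n S)
    rw [hΨ n S hn, hXB _ _ hxn hx (hgood n),
      ih x hx fun i hi => hxy i (Finset.mem_insert_of_mem hi), ih (y n) (hgood n) hne,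
      Finset.prod_insert hn, Finset.sum_insert hn, Finset.erase_insert hn]
    simp only [map_add, map_smul, map_sum, smul_add, Finset.smul_sum, smul_smul]
    have key : ∀ i ∈ S,
        (g x (y i) * (α (y i) * ∏ l ∈ (insert n S).erase i, f (y i) (y l))) •
          B x (Ψ ((insert n S).erase i)) =
        (f x (y n) * (g x (y i) * (α (y i) * ∏ l ∈ S.erase i, f (y i) (y l)))) •
          B (y n) (B x (Ψ (S.erase i))) +
        (g x (y n) * (g (y n) (y i) * (α (y i) * ∏ l ∈ S.erase i, f (y i) (y l)))) •
          B x (B (y n) (Ψ (S.erase i))) := by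
      intro i hi
      have hni : n ≠ i := fun h => hn (h ▸ hi)
      rw [Finset.erase_insert_of_ne hni, Finset.prod_insert (fun h => hn (Finset.mem_of_mem_erase h)),
        hΨ n _ (fun h => hn (Finset.mem_of_mem_erase h)), hBB (y n) x (hgood n) hx, ← add_smul]
      congr 1
      linear_combination -(α (y i) * ∏ l ∈ S.erase i, f (y i) (y l)) *
        hfg x (y i) (y n) (hxy i (Finset.mem_insert_of_mem hi)) hxn (hne i hi).symm
    rw [Finset.sum_congr rfl key, Finset.sum_add_distrib]
    rw [show f x (y n) * (α x * ∏ i ∈ S, f x (y i)) = α x * (f x (y n) * ∏ i ∈ S, f x (y i)) by ring]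
    abel

variable {A : Type*} [CommRing A] {N : ℕ}

/-- On the vacuum the monodromy is triangular in the auxiliary space, so its diagonal entries are
products of local diagonal entries. The vanishing of C is part of the statement because the
induction for the diagonal uses it. -/
theorem mpo_cell_vacuum (β : A) (u : Fin N → A) (b : Spin N) :
    mpo (fun j => cell β (u j)) b (fun _ => 0) 1 0 = 0 ∧
    mpo (fun j => cell β (u j)) b (fun _ => 0) 0 0 = (if b = fun _ => 0 then ∏ j, u j else 0) ∧
    mpo (fun j => cell β (u j)) b (fun _ => 0) 1 1 = if b = fun _ => 0 then 1 else 0 := by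
  induction N with
  | zero => simp [mpo_zero, Subsingleton.elim b (fun _ => 0)]
  | succ N ih =>
    obtain ⟨h₁, h₂, h₃⟩ := ih (fun j => u j.succ) (Fin.tail b)
    have hb : (b = fun _ => 0) ↔ b 0 = 0 ∧ Fin.tail b = fun _ => 0 := by
      refine ⟨fun h => by subst h; exact ⟨rfl, rfl⟩, fun h => funext fun i => ?_⟩
      refine Fin.cases h.1 (fun j => congrFun h.2 j) i
    have ht : (Fin.tail fun _ : Fin (N + 1) => (0 : Fin 2)) = fun _ => 0 := rfl
    simp only [mpo_succ, ht, Matrix.mul_apply, Fin.sum_univ_two, h₁, h₂, h₃, hb, Fin.prod_univ_succ]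
    obtain h | h : b 0 = 0 ∨ b 0 = 1 := by omega
    · simp [h, cell, mul_comm]
    · simp [h, cell]

theorem mono_A_vacuum (β : A) (t : Fin N → A) (x : A) :
    mono β t x 0 0 *ᵥ Pi.single (fun _ => 0) 1 =
      (∏ j, ominus β x (t j)) • Pi.single (fun _ => 0) 1 := by
  ext b
  simp [mono_apply, mpo_cell_vacuum, Pi.single_apply]

theorem mono_D_vacuum (β : A) (t : Fin N → A) (x : A) :
    mono β t x 1 1 *ᵥ Pi.single (fun _ => 0) 1 = Pi.single (fun _ => 0) 1 := by
  ext b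
  simp [mono_apply, mpo_cell_vacuum, Pi.single_apply]

theorem list_prod_eq_noncommProd {M : Type*} [Monoid M] {m : ℕ} (f : Fin m → M)
    (comm : Set.Pairwise (Finset.univ : Finset (Fin m)) fun i j => Commute (f i) (f j)) :
    (List.ofFn f).reverse.prod = Finset.univ.noncommProd f comm := by
  rw [Finset.noncommProd]
  have h : (Finset.univ : Finset (Fin m)).val.map f = ((List.ofFn f).reverse : Multiset M) := by
    rw [Fin.univ_val_map, Multiset.coe_reverse]
  simp only [h, Multiset.noncommProd_coe]

section Field

variable {K : Type*} [Field K] {β : K} {t : Fin N → K}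

/-- The vector obtained by applying to `v` the operators of a commuting family with label in
`S`. -/
def applySub {m : ℕ} (B : Fin m → Op N K) 
    (comm : (Set.univ : Set (Fin m)).Pairwise (Function.onFun Commute B)) (v : Spin N → K)
    (S : Finset (Fin m)) : Spin N → K :=
  S.noncommProd B (comm.mono (Set.subset_univ _)) *ᵥ v

theorem offShell_mulVec {m : ℕ} {X B : K → Op N K} {f g : K → K → K} {α : K → K}
    {v : Spin N → K}
    (hXB : ∀ z w, z ≠ w → X z * B w = f z w • (B w * X z) + g z w • (B z * X w))
    (hBB : ∀ z w, 1 + β * z ≠ 0 → Commute (B z) (B w))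
    (hfg : ∀ x y z, x - y ≠ 0 → x - z ≠ 0 → y - z ≠ 0 → z - y ≠ 0 →
      f x z * g x y + g x z * g z y = g x y * f y z)
    (h₀ : ∀ z, X z *ᵥ v = α z • v) (y : Fin m → K)
    (hy : Function.Injective y) (hu : ∀ i, 1 + β * y i ≠ 0)
    (x : K) (hx : 1 + β * x ≠ 0) (hxy : ∀ i, x ≠ y i) :
    X x *ᵥ ((List.ofFn fun i => B (y i)).reverse.prod *ᵥ v) =
      (α x * ∏ i, f x (y i)) • ((List.ofFn fun i => B (y i)).reverse.prod *ᵥ v) +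
      ∑ i, (g x (y i) * (α (y i) * ∏ l ∈ Finset.univ.erase i, f (y i) (y l))) •
          (B x *ᵥ applySub (fun i => B (y i)) (fun i _ _ _ _ => hBB _ _ (hu i)) v
            (Finset.univ.erase i)) := by
  have h := offShell_expansion (good := fun x => 1 + β * x ≠ 0)
    (X := fun x => (X x).mulVecLin) (B := fun x => (B x).mulVecLin)
    (f := f) (g := g) (α := α) (y := y)
    (Ψ := applySub (fun i => B (y i)) (fun i _ _ _ _ => hBB _ _ (hu i)) v)
    ?_ ?_ ?_ ?_ ?_ hy hu Finset.univ x hx (fun i _ => hxy i)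
  · rw [list_prod_eq_noncommProd _ fun i _ j _ _ => hBB _ _ (hu i)]
    exact h
  · intro z w hzw _ _ u
    simp only [mulVecLin_apply, mulVec_mulVec, hXB z w hzw, add_mulVec, smul_mulVec]
  · intro z w hz _ u
    simp only [mulVecLin_apply, mulVec_mulVec, (hBB z w hz).eq]
  · exact fun x y z hxy hxz hyz => hfg x y z (sub_ne_zero.2 hxy) (sub_ne_zero.2 hxz)
      (sub_ne_zero.2 hyz) (sub_ne_zero.2 hyz.symm)
  · intro z
    simpa only [applySub, Finset.noncommProd_empty, one_mulVec, mulVecLin_apply] using h₀ z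
  · intro i S hi
    simp only [applySub, mulVecLin_apply, mulVec_mulVec]
    rw [Finset.noncommProd_insert_of_notMem _ _ _ _ hi]

/-- The coefficient vectors of the unwanted terms in the action of the transfer matrix. -/
def unwanted {m : ℕ} (ht : ∀ j, 1 + β * t j ≠ 0) (y : Fin m → K)
    (hu : ∀ i, 1 + β * y i ≠ 0) (x : K) (i : Fin m) : Spin N → K :=
  mono β t x 0 1 *ᵥ applySub (fun i => mono β t (y i) 0 1)
    (fun i _ _ _ _ => mono_B_commute (fun j => (ht j).isUnit) _ _ (hu i).isUnit)
    (Pi.single (fun _ => 0) 1) (Finset.univ.erase i)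

theorem offShell_A {m : ℕ} (ht : ∀ j, 1 + β * t j ≠ 0) (y : Fin m → K)
    (hy : Function.Injective y) (hu : ∀ i, 1 + β * y i ≠ 0)
    (x : K) (hx : 1 + β * x ≠ 0) (hxy : ∀ i, x ≠ y i) :
    mono β t x 0 0 *ᵥ betheY β t y =
      ((∏ j, ominus β x (t j)) * ∏ i, (1 + β * y i) / (x - y i)) • betheY β t y +
      ∑ i, (-((1 + β * y i) / (x - y i)) * ((∏ j, ominus β (y i) (t j)) *
        ∏ l ∈ Finset.univ.erase i, (1 + β * y l) / (y i - y l))) • unwanted ht y hu x i := by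
  refine offShell_mulVec (X := fun x => mono β t x 0 0) (B := fun x => mono β t x 0 1)
    (f := fun x y => (1 + β * y) / (x - y)) (g := fun x y => -((1 + β * y) / (x - y)))
    (α := fun x => ∏ j, ominus β x (t j)) ?_ ?_ ?_ (mono_A_vacuum β t) y hy hu x hx hxy
  · intro z w hzw
    have := congrArg ((z - w)⁻¹ • ·) (mono_A_mul_B (fun j => (ht j).isUnit) z w)
    simp only [smul_smul, inv_mul_cancel₀ (sub_ne_zero.2 hzw), one_smul, smul_sub] at this
    refine this.trans ?_
    rw [neg_smul, ← sub_eq_add_neg, div_eq_inv_mul]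
  · exact fun z w hz => mono_B_commute (fun j => (ht j).isUnit) z w hz.isUnit
  · intro x y z h1 h2 h3 h4
    field_simp
    ring

theorem offShell_D {m : ℕ} (ht : ∀ j, 1 + β * t j ≠ 0) (y : Fin m → K)
    (hy : Function.Injective y) (hu : ∀ i, 1 + β * y i ≠ 0)
    (x : K) (hx : 1 + β * x ≠ 0) (hxy : ∀ i, x ≠ y i) :
    mono β t x 1 1 *ᵥ betheY β t y =
      (1 * ∏ i, -((1 + β * x) / (x - y i))) • betheY β t y +
      ∑ i, (((1 + β * y i) / (x - y i)) *
        (1 * ∏ l ∈ Finset.univ.erase i, -((1 + β * y i) / (y i - y l)))) •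
          unwanted ht y hu x i := by
  refine offShell_mulVec (X := fun x => mono β t x 1 1) (B := fun x => mono β t x 0 1)
    (f := fun x y => -((1 + β * x) / (x - y))) (g := fun x y => (1 + β * y) / (x - y))
    (α := fun _ => 1) ?_ ?_ ?_ (fun z => (mono_D_vacuum β t z).trans (one_smul K _).symm)
    y hy hu x hx hxy
  · intro z w hzw
    have := congrArg ((z - w)⁻¹ • ·) (mono_D_mul_B (fun j => (ht j).isUnit) z w)
    simp only [smul_smul, inv_mul_cancel₀ (sub_ne_zero.2 hzw), one_smul, smul_sub] at this
    refine this.trans ?_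
    rw [neg_smul, div_eq_inv_mul, div_eq_inv_mul]
    exact sub_eq_neg_add _ _
  · exact fun z w hz => mono_B_commute (fun j => (ht j).isUnit) z w hz.isUnit
  · intro x y z h1 h2 h3 h4
    field_simp
    ring

theorem transferH_mulVec_betheY {m : ℕ} (ht : ∀ j, 1 + β * t j ≠ 0) {q : K} {y : Fin m → K}
    (hy : IsRootsY β q t y) {x : K} (hx : 1 + β * x ≠ 0) (hxy : ∀ i, x ≠ y i) :
    transferH β q t x *ᵥ betheY β t y = eigenvalueH β q t x y • betheY β t y := by
  obtain ⟨hinj, hunit, hbae⟩ := hy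
  have hu : ∀ i, 1 + β * y i ≠ 0 := fun i => (hunit i).ne_zero
  have hxy' : ∀ i, x - y i ≠ 0 := fun i => sub_ne_zero.2 (hxy i)
  rw [transferH, add_mulVec, smul_mulVec, offShell_A ht y hinj hu x hx hxy,
    offShell_D ht y hinj hu x hx hxy, smul_add, Finset.smul_sum, add_add_add_comm,
    ← Finset.sum_add_distrib, smul_smul, ← add_smul]
  rw [Finset.sum_eq_zero, add_zero]
  · congr 1
    rw [eigenvalueH]
    have h1 : ∏ i, ominus β x (y i) = ∏ i, ((x - y i) / (1 + β * y i)) := by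
      simp [ominus, Ring.inverse_eq_inv', div_eq_mul_inv]
    have h2 : ∏ i, (1 + β * ominus β x (y i)) = ∏ i, ((1 + β * x) / (1 + β * y i)) := by
      refine Finset.prod_congr rfl fun i _ => ?_
      have := hu i
      rw [ominus, Ring.inverse_eq_inv']
      field_simp
      ring
    have h3 : ∏ i, (x - y i) ≠ 0 := Finset.prod_ne_zero_iff.2 fun i _ => hxy' i
    have h4 : ∏ i, (1 + β * y i) ≠ 0 := Finset.prod_ne_zero_iff.2 fun i _ => hu i
    rw [h1, h2]
    simp only [Finset.prod_neg, Finset.prod_div_distrib, Finset.card_univ, Fintype.card_fin]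
    field_simp
  -- The `i`-th unwanted coefficients of `A` and `q D` add up to a multiple of the left side of the
  -- `i`-th Bethe equation. Since `i` exists, `m` is positive and `m - 1` is its genuine
  -- predecessor.
  · intro i _
    rw [smul_smul, ← add_smul]
    convert zero_smul K _ using 2
    have h := hbae i
    rw [Ring.inverse_eq_inv'] at h
    have h3 : ∏ l ∈ Finset.univ.erase i, (y i - y l) ≠ 0 := Finset.prod_ne_zero_iff.2 fun l hl =>
      sub_ne_zero.2 (hinj.ne (Finset.ne_of_mem_erase hl).symm)
    have hi := hu i
    have hm : m = (m - 1) + 1 := by have := i.pos; omega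
    rw [← Finset.mul_prod_erase _ _ (Finset.mem_univ i)] at h
    have hcard : (Finset.univ.erase i : Finset (Fin m)).card = m - 1 := by simp
    simp only [Finset.prod_neg, Finset.prod_div_distrib, Finset.prod_const, hcard]
    have hxi := hxy' i
    generalize hk : m - 1 = k at *
    subst hm
    field_simp
    field_simp at h
    have e₁ : (1 / (1 + β * y i)) ^ (k + 1) * (1 + β * y i) ^ (k + 1) = 1 := by
      rw [← mul_pow, one_div_mul_cancel hi, one_pow]
    have e₂ : ((-1 : K) ^ k) * (-1) ^ k = 1 := by rw [← mul_pow]; simp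
    rw [pow_succ (1 + β * y i)] at e₁
    rw [pow_succ (-1 : K)] at h
    set P := ∏ j, ominus β (y i) (t j)
    set E := ∏ x ∈ Finset.univ.erase i, (1 + β * y x)
    set w := (1 / (1 + β * y i)) ^ (k + 1)
    linear_combination (1 + β * y i) * (-1) ^ k * (1 + β * y i) ^ k * h +
      (1 + β * y i) * P * E * (w * ((1 + β * y i) ^ k * (1 + β * y i)) * e₂ + e₁)

end Field

end

section

variable {A A' : Type*} [CommRing A] [CommRing A'] {N : ℕ}

/-! ### Change of coefficients -/

theorem map_ringInverse (φ : A →+* A') {a : A} (ha : IsUnit a) :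
    φ (Ring.inverse a) = Ring.inverse (φ a) := by
  obtain ⟨u, rfl⟩ := ha
  rw [Ring.inverse_unit, show φ (u : A) = (Units.map (φ : A →* A') u : A') from rfl,
    Ring.inverse_unit, ← map_inv]
  rfl

theorem map_ominus (φ : A →+* A') (β x t : A) (ht : IsUnit (1 + β * t)) :
    φ (ominus β x t) = ominus (φ β) (φ x) (φ t) := by
  simp [ominus, map_ringInverse φ ht]

theorem map_mpo {I : Type*} [Fintype I] [DecidableEq I] (φ : A →+* A')
    (ℓ : Fin N → Fin 2 → Fin 2 → Matrix I I A) (b b' : Spin N) :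
    (mpo ℓ b b').map φ = mpo (fun j s s' => (ℓ j s s').map φ) b b' := by
  have := map_list_prod φ.mapMatrix (List.ofFn fun j => ℓ j (b j) (b' j)).reverse
  simpa [mpo, List.map_ofFn, Function.comp_def] using this

theorem map_cell (φ : A →+* A') (β u : A) (s s' : Fin 2) :
    (cell β u s s').map φ = cell (φ β) (φ u) s s' := by
  fin_cases s <;> fin_cases s' <;> ext a c <;> fin_cases a <;> fin_cases c <;> simp [cell]

theorem map_mono (φ : A →+* A') {β : A} {t : Fin N → A} (ht : ∀ j, IsUnit (1 + β * t j)) (x : A)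
    (a c : Fin 2) :
    (mono β t x a c).map φ = mono (φ β) (fun j => φ (t j)) (φ x) a c := by
  ext b b'
  have := congrFun (congrFun (map_mpo φ (fun j => cell β (ominus β x (t j))) b b') a) c
  simp only [map_cell, map_ominus φ β x _ (ht _)] at this
  simpa only [mono_apply, Matrix.map_apply] using this

theorem map_betheY (φ : A →+* A') {β : A} {t : Fin N → A} (ht : ∀ j, IsUnit (1 + β * t j)) {m : ℕ}
    (y : Fin m → A) (b : Spin N) :
    φ (betheY β t y b) = betheY (φ β) (fun j => φ (t j)) (fun i => φ (y i)) b := by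
  have h := map_list_prod φ.mapMatrix (List.ofFn fun i => mono β t (y i) 0 1).reverse
  simp only [RingHom.mapMatrix_apply, List.map_reverse, List.map_ofFn, Function.comp_def,
    map_mono φ ht] at h
  rw [betheY, RingHom.map_mulVec, h, betheY]
  congr 1
  ext b
  simp [Pi.single_apply, apply_ite φ]

/-! ### Conservation of the number of particles -/

theorem weight_succ (b : Spin (N + 1)) : weight b = b 0 + weight (Fin.tail b) := by
  simp [weight, Fin.sum_univ_succ, Fin.tail]

/-- The ice rule at each site telescopes along the chain. -/
theorem weight_add_of_mpo_ne_zero {ℓ : Fin N → Fin 2 → Fin 2 → Matrix (Fin 2) (Fin 2) A}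
    (hℓ : ∀ j s s' a c, ℓ j s s' a c ≠ 0 → (s : ℕ) + (a : ℕ) = s' + c) {b b' : Spin N} {a c : Fin 2}
    (h : mpo ℓ b b' a c ≠ 0) : weight b + (a : ℕ) = weight b' + c := by
  induction N generalizing c with
  | zero =>
    simp only [mpo_zero, Matrix.one_apply, ne_eq, ite_eq_right_iff, not_forall] at h
    obtain ⟨rfl, -⟩ := h
    simp [weight]
  | succ N ih =>
    rw [mpo_succ, Matrix.mul_apply] at h
    obtain ⟨e, -, he⟩ := Finset.exists_ne_zero_of_sum_ne_zero h
    have h₁ := ih (fun j => hℓ j.succ) (left_ne_zero_of_mul he)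
    have h₂ := hℓ _ _ _ _ _ (right_ne_zero_of_mul he)
    rw [weight_succ, weight_succ]
    omega

theorem weight_mono {β : A} {t : Fin N → A} {x : A} {a c : Fin 2} {b b' : Spin N}
    (h : mono β t x a c b b' ≠ 0) : weight b + (a : ℕ) = weight b' + c := by
  rw [mono_apply] at h
  refine weight_add_of_mpo_ne_zero (fun j s s' a c => ?_) h
  fin_cases s <;> fin_cases s' <;> fin_cases a <;> fin_cases c <;> simp [cell]

theorem weight_mono' {β : A} {t : Fin N → A} {x : A} {a c : Fin 2} {b b' : Spin N}
    (h : mono' β t x a c b b' ≠ 0) : weight b + (a : ℕ) = weight b' + c := by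
  rw [mono'_apply] at h
  refine weight_add_of_mpo_ne_zero (fun j s s' a c => ?_) h
  fin_cases s <;> fin_cases s' <;> fin_cases a <;> fin_cases c <;> simp [cell']

theorem mono_mulVec_supported {β : A} {t : Fin N → A} {x : A} {a c : Fin 2} {v : Spin N → A} {n : ℕ}
    (hv : ∀ b, v b ≠ 0 → weight b = n) {b : Spin N} (hb : (mono β t x a c *ᵥ v) b ≠ 0) :
    weight b + (a : ℕ) = n + c := by
  obtain ⟨b', -, he⟩ := Finset.exists_ne_zero_of_sum_ne_zero hb
  rw [weight_mono (left_ne_zero_of_mul he), hv b' (right_ne_zero_of_mul he)]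

theorem betheY_snoc (β : A) (t : Fin N → A) {m : ℕ} (y : Fin (m + 1) → A) :
    betheY β t y = mono β t (y (Fin.last m)) 0 1 *ᵥ betheY β t (fun i => y i.castSucc) := by
  rw [betheY, betheY, List.ofFn_succ', List.concat_eq_append, List.reverse_append,
    List.reverse_singleton, List.singleton_append, List.prod_cons, mulVec_mulVec]

theorem weight_betheY {β : A} {t : Fin N → A} {m : ℕ} {y : Fin m → A} {b : Spin N}
    (h : betheY β t y b ≠ 0) : weight b = m := by
  induction m generalizing b with
  | zero =>
    have : b = fun _ => 0 := by
      by_contra hb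
      simp [betheY, hb] at h
    simp [this, weight]
  | succ m ih =>
    rw [betheY_snoc] at h
    simpa using mono_mulVec_supported (fun b hb => ih hb) h

theorem mem_weightSpace_iff {n : ℕ} {v : Spin N → A} :
    v ∈ weightSpace N n A ↔ ∀ b, v b ≠ 0 → weight b = n := by
  constructor
  · intro hv
    induction hv using Submodule.span_induction with
    | mem v hv =>
      obtain ⟨b, hb, rfl⟩ := hv
      intro b' hb'
      obtain rfl : b' = b := by
        by_contra h
        simp [h] at hb'
      exact hb
    | zero => simp
    | add v w _ _ hv hw =>
      intro b hb
      by_cases h : v b = 0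
      · exact hw b (by simpa [h] using hb)
      · exact hv b h
    | smul a v _ hv => exact fun b hb => hv b (right_ne_zero_of_mul hb)
  · intro h
    rw [pi_eq_sum_univ' v]
    refine Submodule.sum_mem _ fun b _ => ?_
    by_cases hb : v b = 0
    · simp [hb]
    · refine Submodule.smul_mem _ _ (Submodule.subset_span ⟨b, h b hb, ?_⟩)
      ext b'
      simp [Pi.single_apply]

/-! ### Splitting off the first site -/

/-- The vector `v_s ⊗ v`, with `v_s` on the first site. -/
def consVec (s : Fin 2) : (Spin N → A) →ₗ[A] (Spin (N + 1) → A) where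
  toFun v b := if b 0 = s then v (Fin.tail b) else 0
  map_add' v w := by ext b; by_cases h : b 0 = s <;> simp [h]
  map_smul' a v := by ext b; by_cases h : b 0 = s <;> simp [h]

theorem consVec_apply (s : Fin 2) (v : Spin N → A) (b : Spin (N + 1)) :
    consVec s v b = if b 0 = s then v (Fin.tail b) else 0 := rfl

theorem consVec_single (s : Fin 2) (b : Spin N) :
    consVec s (Pi.single b (1 : A)) = Pi.single (Fin.cons s b) 1 := by
  ext b'
  rw [consVec_apply]
  have : b' = Fin.cons s b ↔ b' 0 = s ∧ Fin.tail b' = b := by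
    constructor
    · rintro rfl; simp
    · rintro ⟨rfl, rfl⟩; simp
  by_cases h : b' 0 = s <;> simp [Pi.single_apply, this, h]

theorem mono_mulVec_consVec (β : A) (t : Fin (N + 1) → A) (x : A) (a c s : Fin 2)
    (v : Spin N → A) (b : Spin (N + 1)) :
    (mono β t x a c *ᵥ consVec s v) b =
      ∑ e, cell β (ominus β x (t 0)) (b 0) s e c *
        (mono β (fun j => t j.succ) x a e *ᵥ v) (Fin.tail b) := by
  simp only [Matrix.mulVec, dotProduct, mono_apply]
  rw [sum_spin_succ, Finset.sum_eq_single s]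
  · simp only [mpo_succ, consVec_apply, Fin.cons_zero, Fin.tail_cons, if_true, Matrix.mul_apply,
      Finset.sum_mul, Finset.mul_sum]
    rw [Finset.sum_comm]
    exact Finset.sum_congr rfl fun _ _ => Finset.sum_congr rfl fun _ _ => by ring
  · intro s' _ hs'
    simp [consVec_apply, hs']
  · simp

theorem mono_B_consVec_zero (β : A) (t : Fin (N + 1) → A) (x : A) (v : Spin N → A) :
    mono β t x 0 1 *ᵥ consVec 0 v =
      consVec 0 (mono β (fun j => t j.succ) x 0 1 *ᵥ v) +
        (1 + β * ominus β x (t 0)) • consVec 1 (mono β (fun j => t j.succ) x 0 0 *ᵥ v) := by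
  ext b
  rw [mono_mulVec_consVec]
  obtain h | h : b 0 = 0 ∨ b 0 = 1 := by omega
  · simp [h, cell, consVec_apply]
  · simp [h, cell, consVec_apply]

/-- The first site is the rightmost factor of the monodromy, and when occupied it cannot absorb the
particle that B sends in from the auxiliary space. -/
theorem mono_B_consVec_one (β : A) (t : Fin (N + 1) → A) (x : A) (v : Spin N → A) :
    mono β t x 0 1 *ᵥ consVec 1 v = 0 := by
  ext b
  rw [mono_mulVec_consVec]
  obtain h | h : b 0 = 0 ∨ b 0 = 1 := by omega
  · simp [h, cell]
  · simp [h, cell]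

theorem vacuum_succ :
    (Pi.single (fun _ => 0) 1 : Spin (N + 1) → A) = consVec 0 (Pi.single (fun _ => 0) 1) := by
  rw [consVec_single]
  congr 1
  ext i
  refine Fin.cases rfl (fun _ => rfl) i

/-- The component with an empty first site evolves under the shorter chain. The other component is
killed by the next B, so its form is irrelevant here. -/
theorem betheY_succ_site (β : A) (t : Fin (N + 1) → A) {m : ℕ} (y : Fin m → A) :
    ∃ w, betheY β t y = consVec 0 (betheY β (fun j => t j.succ) y) + consVec 1 w := by
  induction m with
  | zero => exact ⟨0, by simp only [betheY, List.ofFn_zero, List.reverse_nil, List.prod_nil,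
      one_mulVec, vacuum_succ, map_zero, add_zero]⟩
  | succ m ih =>
    obtain ⟨w, hw⟩ := ih fun i => y i.castSucc
    refine ⟨(1 + β * ominus β (y (Fin.last m)) (t 0)) •
      (mono β (fun j => t j.succ) (y (Fin.last m)) 0 0 *ᵥ
        betheY β (fun j => t j.succ) fun i => y i.castSucc), ?_⟩
    rw [betheY_snoc, hw, mulVec_add, mono_B_consVec_zero, mono_B_consVec_one, add_zero,
      betheY_snoc β (fun j => t j.succ), map_smul]

/-- Only the last B can leave a particle on the first site, since any particle put there earlier
would annihilate the vector. -/
theorem betheY_snoc_succ_site (β : A) (t : Fin (N + 1) → A) {m : ℕ} (y : Fin (m + 1) → A) :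
    betheY β t y = consVec 0 (betheY β (fun j => t j.succ) y) +
      (1 + β * ominus β (y (Fin.last m)) (t 0)) •
        consVec 1 (mono β (fun j => t j.succ) (y (Fin.last m)) 0 0 *ᵥ
          betheY β (fun j => t j.succ) fun i => y i.castSucc) := by
  obtain ⟨w, hw⟩ := betheY_succ_site β t fun i => y i.castSucc
  rw [betheY_snoc, hw, mulVec_add, mono_B_consVec_zero, mono_B_consVec_one, add_zero,
    betheY_snoc β (fun j => t j.succ)]

/-! ### Spanning at `q = 0` -/

/-- These are the Bethe equations at `q = 0`: every unwanted coefficient of A contains a factor `∏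
j, ominus β (y i) (t j)`. The off-shell formula lives in the fraction field, so the denominators are
cleared to obtain an identity over `R`. -/
theorem prod_smul_mono_A_betheY {R : Type*} [CommRing R] [IsDomain R] {β : R} {t : Fin N → R}
    (ht : ∀ j, IsUnit (1 + β * t j)) {m : ℕ} {y : Fin m → R} (hy : Function.Injective y)
    (hu : ∀ i, IsUnit (1 + β * y i)) (hyt : ∀ i, ∏ j, ominus β (y i) (t j) = 0)
    {x : R} (hx : IsUnit (1 + β * x)) (hxy : ∀ i, x ≠ y i) :
    (∏ i, (x - y i)) • (mono β t x 0 0 *ᵥ betheY β t y) =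
      ((∏ j, ominus β x (t j)) * ∏ i, (1 + β * y i)) • betheY β t y := by
  let φ := algebraMap R (FractionRing R)
  have hφ : Function.Injective φ := IsFractionRing.injective R (FractionRing R)
  have hunit : ∀ z : R, IsUnit (1 + β * z) → 1 + φ β * φ z ≠ 0 := fun z hz => by
    simpa using (hz.map φ).ne_zero
  have h := offShell_A (β := φ β) (t := fun j => φ (t j)) (fun j => hunit _ (ht j))
    (fun i => φ (y i)) (hφ.comp hy) (fun i => hunit _ (hu i)) (φ x) (hunit x hx)
    (fun i => hφ.ne (hxy i))
  rw [Finset.sum_eq_zero, add_zero] at h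
  · have h' := congrArg (fun v => φ (∏ i, (x - y i)) • v) h
    funext b
    apply hφ
    have h'' := congrFun h' b
    simp only [smul_smul] at h''
    simp only [Pi.smul_apply, smul_eq_mul, map_mul, map_betheY φ ht, RingHom.map_mulVec,
      map_mono φ ht] at h'' ⊢
    have hv : (φ ∘ betheY β t y) =
        betheY (φ β) (fun j => φ (t j)) (fun i => φ (y i)) := funext (map_betheY φ ht y)
    rw [hv, h'']
    congr 1
    simp only [map_prod, map_sub, map_add, map_mul, map_one, Finset.prod_div_distrib,
      map_ominus φ β x _ (ht _)]
    have h3 : ∏ i, (φ x - φ (y i)) ≠ 0 :=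
      Finset.prod_ne_zero_iff.2 fun i _ => sub_ne_zero.2 (hφ.ne (hxy i))
    field_simp
  · intro i _
    have := congrArg φ (hyt i)
    simp only [map_prod, map_ominus φ β _ _ (ht _), map_zero] at this
    rw [this]
    simp

end

section

variable {R : Type*} [CommRing R] {N : ℕ}

/-- The Bethe vectors with `n` distinct roots among the inhomogeneities. -/
def betheSpan (β : R) (t : Fin N → R) (n : ℕ) : Submodule R (Spin N → R) :=
  Submodule.span R {v | ∃ f : Fin n → Fin N, Function.Injective f ∧
    v = betheY β t fun i => t (f i)}

theorem prod_ominus_eq_zero (β : R) (t : Fin N → R) (j : Fin N) :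
    ∏ l, ominus β (t j) (t l) = 0 :=
  Finset.prod_eq_zero (Finset.mem_univ j) (by simp [ominus])

theorem isUnit_ringInverse {A : Type*} [CommRing A] {a : A} (ha : IsUnit a) :
    IsUnit (Ring.inverse a) := by
  obtain ⟨u, rfl⟩ := ha
  rw [Ring.inverse_unit]
  exact (u⁻¹).isUnit

theorem injective_of_isUnit_sub [IsDomain R] {t : Fin N → R} (hd : ∀ i j, i ≠ j → IsUnit (t i - t j)) :
    Function.Injective t := fun i j h => by
  by_contra hij
  exact (hd i j hij).ne_zero (sub_eq_zero.2 h)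

theorem consVec_mem {M : ℕ} {W : Submodule R (Spin N → R)} {W' : Submodule R (Spin M → R)}
    (g : (Spin N → R) →ₗ[R] (Spin M → R)) (s : Set (Spin N → R)) (hW : W = Submodule.span R s)
    (h : ∀ v ∈ s, g v ∈ W') {v : Spin N → R} (hv : v ∈ W) : g v ∈ W' := by
  subst hW
  have : Submodule.span R s ≤ W'.comap g := Submodule.span_le.2 h
  exact this hv

/-- Induction on `N`, triangular with respect to the letter on the first site: roots avoiding `t 0`
give vectors with an empty first site, and adjoining `t 0` as last root gives, modulo these, a unit
multiple of an occupied first site. -/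
theorem weightSpace_le_betheSpan [IsDomain R] {β : R} {t : Fin N → R} (ht : ∀ j, IsUnit (1 + β * t j))
    (hd : ∀ i j, i ≠ j → IsUnit (t i - t j)) (n : ℕ) :
    weightSpace N n R ≤ betheSpan β t n := by
  induction N generalizing n with
  | zero =>
    refine Submodule.span_le.2 ?_
    rintro _ ⟨b, hb, rfl⟩
    obtain rfl : n = 0 := by simpa [weight] using hb.symm
    refine Submodule.subset_span ⟨Fin.elim0, fun i => i.elim0, ?_⟩
    simp only [betheY, List.ofFn_zero, List.reverse_nil, List.prod_nil, one_mulVec]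
    rw [Subsingleton.elim b fun _ => 0]
  | succ N ih =>
    have ht' := fun j : Fin N => ht j.succ
    have hd' : ∀ i j : Fin N, i ≠ j → IsUnit (t i.succ - t j.succ) := fun i j hij =>
      hd _ _ ((Fin.succ_injective N).ne hij)
    have hinj := injective_of_isUnit_sub hd'
    have h₀ : ∀ v ∈ weightSpace N n R, consVec 0 v ∈ betheSpan β t n := by
      intro v hv
      refine consVec_mem (consVec 0) _ rfl ?_ (ih ht' hd' n hv)
      rintro _ ⟨f, hf, rfl⟩
      refine Submodule.subset_span ⟨fun i => (f i).succ, (Fin.succ_injective N).comp hf, ?_⟩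
      cases n with
      | zero => 
        simp only [betheY, List.ofFn_zero, List.reverse_nil, List.prod_nil, one_mulVec,
          vacuum_succ]
      | succ n =>
        rw [betheY_snoc_succ_site]
        have h := prod_smul_mono_A_betheY ht' (y := fun i : Fin n => t (f i.castSucc).succ)
          (hinj.comp (hf.comp (Fin.castSucc_injective n))) (fun i => ht' _)
          (fun i => prod_ominus_eq_zero β (fun j => t j.succ) _)
          (x := t (f (Fin.last n)).succ) (ht' _) 
          (fun i => hinj.ne (hf.ne (Fin.castSucc_lt_last i).ne'))
        -- The last root is an inhomogeneity of the shorter chain, so A has eigenvalue zero there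
        -- and the component with occupied first site disappears.
        rw [prod_ominus_eq_zero β (fun j : Fin N => t j.succ), zero_mul, zero_smul] at h
        have hu : IsUnit (∏ i : Fin n, (t (f (Fin.last n)).succ - t (f i.castSucc).succ)) := by
          rw [IsUnit.prod_univ_iff]
          exact fun i => hd' _ _ (hf.ne (Fin.castSucc_lt_last i).ne')
        rw [hu.smul_eq_zero.1 h, map_zero, smul_zero, add_zero]
    refine Submodule.span_le.2 ?_
    rintro _ ⟨b, hb, rfl⟩
    rw [weight_succ] at hb
    have hcons : (Pi.single b 1 : Spin (N + 1) → R) = consVec (b 0) (Pi.single (Fin.tail b) 1) := by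
      rw [consVec_single, Fin.cons_self_tail]
    rw [SetLike.mem_coe, hcons]
    obtain h | h : b 0 = 0 ∨ b 0 = 1 := by omega
    · rw [h] at hb ⊢
      exact h₀ _ (Submodule.subset_span ⟨_, by simpa using hb, rfl⟩)
    · rw [h] at hb ⊢
      obtain ⟨m, rfl⟩ : ∃ m, n = m + 1 := ⟨weight (Fin.tail b), by simp at hb; omega⟩
      have hb' : weight (Fin.tail b) = m := by simp at hb; omega
      refine consVec_mem (consVec 1) _ rfl ?_
        (ih ht' hd' m (Submodule.subset_span ⟨_, hb', rfl⟩))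
      rintro _ ⟨f, hf, rfl⟩
      -- The root `t 0` is put last because the last B is the one that fills the first site.
      set y : Fin (m + 1) → R := fun i => t (Fin.snoc (α := fun _ => Fin (N + 1))
        (fun i => (f i).succ) 0 i) with hy
      have hmem : betheY β t y ∈ betheSpan β t (m + 1) := by
        refine Submodule.subset_span ⟨_, ?_, rfl⟩
        exact Fin.snoc_injective_iff.2 ⟨(Fin.succ_injective N).comp hf, by simp⟩
      rw [betheY_snoc_succ_site] at hmem
      have hlast : y (Fin.last m) = t 0 := by simp [hy]
      have hinit : (fun i : Fin m => y i.castSucc) = fun i => t (f i).succ := by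
        ext i; simp [hy]
      have h1 : (1 + β * ominus β (y (Fin.last m)) (t 0)) = 1 := by simp [hlast, ominus]
      rw [h1, one_smul, hinit, hlast] at hmem
      have hmem' := (Submodule.add_mem_iff_right _ (h₀ _ (mem_weightSpace_iff.2 fun b hb =>
        weight_betheY hb))).1 hmem
      have h := prod_smul_mono_A_betheY ht' (y := fun i : Fin m => t (f i).succ)
          (hinj.comp hf) (fun i => ht' _)
          (fun i => prod_ominus_eq_zero β (fun j => t j.succ) _)
          (x := t 0) (ht 0) (fun i => (injective_of_isUnit_sub hd).ne (Fin.succ_ne_zero _).symm)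
      -- The eigenvalue of A at `t 0` is invertible, as `t 0` differs from every other inhomogeneity
      -- by a unit.
      have hu : IsUnit ((∏ j : Fin N, ominus β (t 0) (t j.succ)) *
          ∏ i : Fin m, (1 + β * t (f i).succ)) := by
        refine IsUnit.mul ?_ ?_
        · rw [IsUnit.prod_univ_iff]
          exact fun i => (hd _ _ (Fin.succ_ne_zero _).symm).mul (isUnit_ringInverse (ht _))
        · rw [IsUnit.prod_univ_iff]
          exact fun i => ht _
      have hmem'' := Submodule.smul_mem _ (∏ i : Fin m, (t 0 - t (f i).succ)) hmem'
      rw [← map_smul, h, map_smul] at hmem''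
      exact (Submodule.smul_mem_iff_of_isUnit _ hu).1 hmem''

end

section

/-! ### Power series solutions of the Bethe equations -/

section FixedPoint

variable {R : Type*} [CommRing R] {ι : Type*}

theorem eq_of_forall_X_pow_dvd_sub {a b : PowerSeries R}
    (h : ∀ k, (PowerSeries.X : PowerSeries R) ^ k ∣ a - b) : a = b := by
  ext d
  have := PowerSeries.X_pow_dvd_iff.1 (h (d + 1)) d (Nat.lt_succ_self d)
  rwa [map_sub, sub_eq_zero] at this

/-- Banach's fixed point theorem for the `q`-adic topology, where contraction means gaining one
power of `q`. -/
theorem existsUnique_fixedPoint (Γ : (ι → PowerSeries R) → ι → PowerSeries R)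
    (hΓ : ∀ k w w', (∀ i, (PowerSeries.X : PowerSeries R) ^ k ∣ w i - w' i) →
      ∀ i, (PowerSeries.X : PowerSeries R) ^ (k + 1) ∣ Γ w i - Γ w' i) :
    ∃! w, Γ w = w := by
  let u : ℕ → ι → PowerSeries R := fun k => Γ^[k] 0
  have hu : ∀ k, u (k + 1) = Γ (u k) := fun k => Function.iterate_succ_apply' Γ k 0
  have hstep : ∀ k i, (PowerSeries.X : PowerSeries R) ^ k ∣ u (k + 1) i - u k i := by
    intro k
    induction k with
    | zero => simp
    | succ k ih =>
      rw [hu (k + 1), hu k]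
      exact hΓ k _ _ (by rwa [← hu k])
  have hstep' : ∀ k l i, (PowerSeries.X : PowerSeries R) ^ k ∣ u (k + l) i - u k i := by
    intro k l i
    induction l with
    | zero => simp
    | succ l ih =>
      have := dvd_add ((pow_dvd_pow _ (Nat.le_add_right k l)).trans (hstep (k + l) i)) ih
      rwa [sub_add_sub_cancel] at this
  -- The coefficient of degree `d` is stable from the iterate `d + 1` on, so the limit is read off
  -- diagonally.
  let w : ι → PowerSeries R := fun i => PowerSeries.mk fun d => PowerSeries.coeff d (u (d + 1) i)
  have hw : ∀ k i, (PowerSeries.X : PowerSeries R) ^ k ∣ w i - u k i := by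
    intro k i
    refine PowerSeries.X_pow_dvd_iff.2 fun d hd => ?_
    obtain ⟨l, rfl⟩ : ∃ l, k = d + 1 + l := ⟨k - (d + 1), by omega⟩
    have := PowerSeries.X_pow_dvd_iff.1 (hstep' (d + 1) l i) d (Nat.lt_succ_self d)
    rw [map_sub, sub_eq_zero] at this
    rw [map_sub, PowerSeries.coeff_mk, this, sub_self]
  refine ⟨w, ?_, fun w' hw' => ?_⟩
  · funext i
    refine eq_of_forall_X_pow_dvd_sub fun k => ?_
    have h₁ := hΓ k w (u k) (hw k) i
    rw [← hu k] at h₁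
    have h₂ := dvd_sub h₁ (hw (k + 1) i)
    rw [sub_sub_sub_cancel_right] at h₂
    exact (pow_dvd_pow _ (Nat.le_succ k)).trans h₂
  · funext i
    refine eq_of_forall_X_pow_dvd_sub fun k => ?_
    have : ∀ k i, (PowerSeries.X : PowerSeries R) ^ k ∣ w' i - u k i := by
      intro k
      induction k with
      | zero => simp
      | succ k ih =>
        intro i
        rw [hu k, ← show Γ w' = w' from hw']
        exact hΓ k _ _ ih i
    have := dvd_sub (this k i) (hw k i)
    rwa [sub_sub_sub_cancel_right] at this

end FixedPoint

theorem bethe_equation_iff {A : Type*} [CommRing A] {N m : ℕ} {β q : A} {t : Fin N → A}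
    (ht : ∀ j, IsUnit (1 + β * t j)) {y : A} (hy : IsUnit (1 + β * y)) (P : A) :
    (-1) ^ m * P * Ring.inverse (1 + β * y) ^ m * ∏ j, ominus β y (t j) + q = 0 ↔
      (-1) ^ m * P * ∏ j, (y - t j) + q * (1 + β * y) ^ m * ∏ j, (1 + β * t j) = 0 := by
  have h₁ : (1 + β * y) ^ m * Ring.inverse (1 + β * y) ^ m = 1 := by
    rw [← mul_pow, Ring.mul_inverse_cancel _ hy, one_pow]
  have h₂ : (∏ j, (1 + β * t j)) * ∏ j, ominus β y (t j) = ∏ j, (y - t j) := by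
    rw [← Finset.prod_mul_distrib]
    refine Finset.prod_congr rfl fun j _ => ?_
    rw [ominus, mul_left_comm, Ring.mul_inverse_cancel _ (ht j), mul_one]
  have hu : IsUnit ((1 + β * y) ^ m * ∏ j, (1 + β * t j)) :=
    (hy.pow m).mul (by rw [IsUnit.prod_univ_iff]; exact ht)
  rw [← hu.mul_right_eq_zero]
  refine iff_of_eq (congrArg (· = 0) ?_)
  rw [← h₂]
  linear_combination (-1) ^ m * P * ((∏ j, (1 + β * t j)) * ∏ j, ominus β y (t j)) * h₁

section Solutions

variable {R : Type*} [CommRing R] {N m : ℕ} (β : R) (t : Fin N → R) (f : Fin m → Fin N)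

/-- The map whose fixed points `w` correspond to the solutions `y_i = t_{f i} + q w_i` of the Bethe
equations. -/
def betheMap (w : Fin m → PowerSeries R) (i : Fin m) : PowerSeries R :=
  -(-1) ^ m * (∏ j, (1 + const β * const (t j))) *
    (1 + const β * (const (t (f i)) + PowerSeries.X * w i)) ^ m *
    Ring.inverse ((∏ l, (1 + const β * (const (t (f l)) + PowerSeries.X * w l))) *
      ∏ j ∈ Finset.univ.erase (f i), (const (t (f i)) + PowerSeries.X * w i - const (t j)))

variable {β t}

theorem isUnit_betheMap_denominator (ht : ∀ j, IsUnit (1 + β * t j))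
    (hd : ∀ i j, i ≠ j → IsUnit (t i - t j)) (w : Fin m → PowerSeries R) (i : Fin m) :
    IsUnit ((∏ l, (1 + const β * (const (t (f l)) + PowerSeries.X * w l))) *
      ∏ j ∈ Finset.univ.erase (f i), (const (t (f i)) + PowerSeries.X * w i - const (t j))) := by
  rw [PowerSeries.isUnit_iff_constantCoeff]
  simp only [const, map_mul, map_prod, map_add, map_sub, map_one, PowerSeries.constantCoeff_C,
    PowerSeries.constantCoeff_X, zero_mul, add_zero]
  refine IsUnit.mul ?_ ?_
  · rw [IsUnit.prod_univ_iff]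
    exact fun i => ht _
  · rw [IsUnit.prod_iff]
    exact fun j hj => hd _ _ (Finset.ne_of_mem_erase hj).symm

/-- The map depends on `w` only through `q w`, which is known modulo `q ^ (k + 1)` once `w` is known
modulo `q ^ k`. Unit denominators let the map descend to the quotient. -/
theorem betheMap_contracting (ht : ∀ j, IsUnit (1 + β * t j))
    (hd : ∀ i j, i ≠ j → IsUnit (t i - t j)) (k : ℕ) (w w' : Fin m → PowerSeries R)
    (h : ∀ i, (PowerSeries.X : PowerSeries R) ^ k ∣ w i - w' i) (i : Fin m) :
    (PowerSeries.X : PowerSeries R) ^ (k + 1) ∣ betheMap β t f w i - betheMap β t f w' i := by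
  let π := Ideal.Quotient.mk (Ideal.span {(PowerSeries.X : PowerSeries R) ^ (k + 1)})
  have hπ : ∀ a b, π a = π b ↔ (PowerSeries.X : PowerSeries R) ^ (k + 1) ∣ a - b := fun a b => by
    rw [Ideal.Quotient.eq, Ideal.mem_span_singleton]
  have hw : ∀ i, π PowerSeries.X * π (w i) = π PowerSeries.X * π (w' i) := fun i => by
    rw [← map_mul, ← map_mul, hπ, ← mul_sub, pow_succ']
    exact mul_dvd_mul_left _ (h i)
  rw [← hπ]
  simp only [betheMap, map_mul, map_ringInverse π (isUnit_betheMap_denominator f ht hd _ i), map_pow,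
    map_prod, map_add, map_sub, hw, map_one]

/-- The factor `y i - t (f i) = q w i` makes the whole equation divisible by `q`. After cancelling
`q`, the coefficient of `w i` is a unit, so the equation can be solved for it. -/
theorem betheMap_eq_iff (ht : ∀ j, IsUnit (1 + β * t j))
    (hd : ∀ i j, i ≠ j → IsUnit (t i - t j)) [IsDomain R] (w : Fin m → PowerSeries R)
    (y : Fin m → PowerSeries R) (hy : ∀ i, y i = const (t (f i)) + PowerSeries.X * w i) (i : Fin m) :
    betheMap β t f w i = w i ↔ (-1) ^ m * (∏ l, (1 + const β * y l)) * ∏ j, (y i - const (t j)) +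
      PowerSeries.X * (1 + const β * y i) ^ m * ∏ j, (1 + const β * const (t j)) = 0 := by
  have hU := isUnit_betheMap_denominator f ht hd w i
  have hinv := Ring.mul_inverse_cancel _ hU
  simp only [betheMap, ← hy] at hinv hU ⊢
  rw [← Finset.mul_prod_erase _ (fun j => y i - const (t j)) (Finset.mem_univ (f i)),
    show y i - const (t (f i)) = PowerSeries.X * w i by rw [hy]; ring]
  have hs : ((-1 : PowerSeries R) ^ m) * (-1) ^ m = 1 := by rw [← mul_pow]; simp
  set P := ∏ l, (1 + const β * y l)
  set E := ∏ j ∈ Finset.univ.erase (f i), (y i - const (t j))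
  set T := ∏ j, (1 + const β * const (t j))
  set D := (1 + const β * y i) ^ m
  set I := Ring.inverse (P * E)
  constructor
  · intro h
    linear_combination -(-1) ^ m * P * E * PowerSeries.X * h +
      -(PowerSeries.X * T * D) * (P * E * I * hs + hinv)
  · intro h
    apply mul_left_cancel₀ (PowerSeries.X_ne_zero (R := R))
    linear_combination -(-1) ^ m * I * h + w i * PowerSeries.X * (P * E * I * hs + hinv)

theorem isUnit_of_constantCoeff {y : PowerSeries R} {s : R} (hy : PowerSeries.constantCoeff y = s)
    (hs : IsUnit (1 + β * s)) : IsUnit (1 + const β * y) := by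
  rw [PowerSeries.isUnit_iff_constantCoeff]
  simpa [const, hy] using hs

theorem isUnit_const {s : R} (hs : IsUnit (1 + β * s)) : IsUnit (1 + const β * const s) :=
  isUnit_of_constantCoeff (by simp [const]) hs

theorem eq_const_add_X_mul {y : PowerSeries R} {s : R} (hy : PowerSeries.constantCoeff y = s) :
    ∃ w, y = const s + PowerSeries.X * w := by
  obtain ⟨w, hw⟩ := PowerSeries.X_dvd_iff.2 (show PowerSeries.constantCoeff (y - const s) = 0 by
    simp [const, hy])
  exact ⟨w, by rw [← hw]; ring⟩

variable [IsDomain R]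

/-- Setting `q = 0` in the polynomial form of the equations leaves a unit times the product of the
`y_i(0) - t_j`. -/
theorem IsRootsY.exists_leading (ht : ∀ j, IsUnit (1 + β * t j)) {y : Fin m → PowerSeries R}
    (hy : IsRootsY (const β) PowerSeries.X (fun j => const (t j)) y) :
    ∃ f : Fin m → Fin N, ∀ i, PowerSeries.constantCoeff (y i) = t (f i) := by
  obtain ⟨-, hu, hb⟩ := hy
  have : ∀ i, ∃ j, PowerSeries.constantCoeff (y i) = t j := by
    intro i
    have h := congrArg PowerSeries.constantCoeff
      ((bethe_equation_iff (fun j => isUnit_const (ht j)) (hu i) _).1 (hb i))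
    have hP : IsUnit (∏ l, (1 + const β * y l)) := by
      rw [IsUnit.prod_univ_iff]; exact hu
    have hP' := (hP.map (PowerSeries.constantCoeff (R := R))).ne_zero
    simp only [map_add, map_mul (PowerSeries.constantCoeff (R := R)), map_pow, map_neg, map_one,
      map_zero, PowerSeries.constantCoeff_X, zero_mul, add_zero, mul_eq_zero (M₀ := R)] at h
    have h' := h.resolve_left (not_or.2 ⟨by simp, hP'⟩)
    rw [map_prod, Finset.prod_eq_zero_iff] at h'
    obtain ⟨j, -, hj⟩ := h'
    exact ⟨j, by simpa [const, sub_eq_zero] using hj⟩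
  choose f hf using this
  exact ⟨f, hf⟩

theorem bethe_solution_unique (ht : ∀ j, IsUnit (1 + β * t j))
    (hd : ∀ i j, i ≠ j → IsUnit (t i - t j)) {y y' : Fin m → PowerSeries R}
    (hy : IsRootsY (const β) PowerSeries.X (fun j => const (t j)) y)
    (hy' : IsRootsY (const β) PowerSeries.X (fun j => const (t j)) y')
    (h : ∀ i, PowerSeries.constantCoeff (y i) = PowerSeries.constantCoeff (y' i)) : y = y' := by
  obtain ⟨f, hf⟩ := hy.exists_leading ht
  choose w hw using fun i => eq_const_add_X_mul (hf i)
  choose w' hw' using fun i => eq_const_add_X_mul ((h i).symm.trans (hf i))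
  have hfix : ∀ {y w : Fin m → PowerSeries R},
      IsRootsY (const β) PowerSeries.X (fun j => const (t j)) y →
      (∀ i, y i = const (t (f i)) + PowerSeries.X * w i) → betheMap β t f w = w :=
    fun hy hw => funext fun i => (betheMap_eq_iff f ht hd _ _ hw i).2
      ((bethe_equation_iff (fun j => isUnit_const (ht j)) (hy.2.1 i) _).1 (hy.2.2 i))
  have := (existsUnique_fixedPoint _ (betheMap_contracting f ht hd)).unique (hfix hy hw)
    (hfix hy' hw')
  funext i
  rw [hw, hw', this]

theorem IsRootsY.comp_perm {A : Type*} [CommRing A] {β q : A} {t : Fin N → A} {y : Fin m → A}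
    (hy : IsRootsY β q t y) (σ : Equiv.Perm (Fin m)) : IsRootsY β q t (y ∘ σ) := by
  refine ⟨hy.1.comp σ.injective, fun i => hy.2.1 _, fun i => ?_⟩
  have := hy.2.2 (σ i)
  rw [← Equiv.prod_comp σ fun l => 1 + β * y l] at this
  exact this

/-- If two roots had the same constant term, exchanging them would give a solution with the same
constant terms, hence the same solution; the two roots would then coincide. -/
theorem IsRootsY.exists_leading_injective (ht : ∀ j, IsUnit (1 + β * t j))
    (hd : ∀ i j, i ≠ j → IsUnit (t i - t j)) {y : Fin m → PowerSeries R}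
    (hy : IsRootsY (const β) PowerSeries.X (fun j => const (t j)) y) :
    ∃ f : Fin m → Fin N, Function.Injective f ∧
      ∀ i, PowerSeries.constantCoeff (y i) = t (f i) := by
  obtain ⟨f, hf⟩ := hy.exists_leading ht
  refine ⟨f, fun i l hil => ?_, hf⟩
  have := bethe_solution_unique ht hd hy (hy.comp_perm (Equiv.swap i l)) fun j => by
    rw [Function.comp_apply, hf, hf]
    obtain rfl | hi := eq_or_ne j i
    · rw [Equiv.swap_apply_left, hil]
    · obtain rfl | hl := eq_or_ne j l
      · rw [Equiv.swap_apply_right, hil]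
      · rw [Equiv.swap_apply_of_ne_of_ne hi hl]
  refine hy.1 ((congrFun this i).trans ?_)
  rw [Function.comp_apply, Equiv.swap_apply_left]

theorem exists_bethe_solution (ht : ∀ j, IsUnit (1 + β * t j))
    (hd : ∀ i j, i ≠ j → IsUnit (t i - t j)) {f : Fin m → Fin N} (hf : Function.Injective f) :
    ∃ y : Fin m → PowerSeries R, IsRootsY (const β) PowerSeries.X (fun j => const (t j)) y ∧
      ∀ i, PowerSeries.constantCoeff (y i) = t (f i) := by
  obtain ⟨w, hw, -⟩ := existsUnique_fixedPoint _ (betheMap_contracting (β := β) f ht hd)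
  let y : Fin m → PowerSeries R := fun i => const (t (f i)) + PowerSeries.X * w i
  have hc : ∀ i, PowerSeries.constantCoeff (y i) = t (f i) := fun i => by simp [y, const]
  have hu : ∀ i, IsUnit (1 + const β * y i) := fun i => isUnit_of_constantCoeff (hc i) (ht _)
  refine ⟨y, ⟨fun i l hil => hf (injective_of_isUnit_sub hd ?_), hu, fun i => ?_⟩, hc⟩
  · rw [← hc, ← hc, hil]
  · exact (bethe_equation_iff (fun j => isUnit_const (ht j)) (hu i) _).2
      ((betheMap_eq_iff f ht hd w y (fun _ => rfl) i).1 (congrFun hw i))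

end Solutions

end

section

variable {N m : ℕ}

/-! ### Counting -/

/-- The positions of the letters `1` of a binary string. -/
def spinSupport (b : Spin N) : Finset (Fin N) := Finset.univ.filter fun j => b j = 1

theorem card_spinSupport (b : Spin N) : (spinSupport b).card = weight b := by
  rw [spinSupport, Finset.card_filter, weight]
  refine Finset.sum_congr rfl fun j _ => ?_
  obtain h | h : b j = 0 ∨ b j = 1 := by omega
  · simp [h]
  · simp [h]

theorem spinSupport_injective : Function.Injective (spinSupport (N := N)) := by
  intro b b' h
  funext j
  have := Finset.ext_iff.1 h j
  simp only [spinSupport, Finset.mem_filter, Finset.mem_univ, true_and] at this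
  omega

theorem spinSupport_surjective : Function.Surjective (spinSupport (N := N)) := by
  intro s
  refine ⟨fun j => if j ∈ s then 1 else 0, ?_⟩
  ext j
  simp [spinSupport]

theorem card_weight_eq (N n : ℕ) : Fintype.card {b : Spin N // weight b = n} = N.choose n := by
  rw [Fintype.card_subtype, ← Finset.card_image_of_injective _ spinSupport_injective]
  have h := Finset.card_powersetCard n (Finset.univ : Finset (Fin N))
  rw [Finset.card_univ, Fintype.card_fin] at h
  rw [← h]
  refine congrArg Finset.card ?_
  ext s
  simp only [Finset.mem_image, Finset.mem_filter, Finset.mem_univ, true_and,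
    Finset.mem_powersetCard_univ]
  constructor
  · rintro ⟨b, rfl, rfl⟩
    exact card_spinSupport b
  · rintro rfl
    obtain ⟨b, rfl⟩ := spinSupport_surjective s
    exact ⟨b, (card_spinSupport b).symm, rfl⟩

theorem exists_perm_of_range_eq {α : Type*} {y y' : Fin m → α} (hy : Function.Injective y)
    (hy' : Function.Injective y') (h : Set.range y = Set.range y') :
    ∃ σ : Equiv.Perm (Fin m), y' = y ∘ σ := by
  refine ⟨((Equiv.ofInjective y' hy').trans (Equiv.setCongr h.symm)).trans
    (Equiv.ofInjective y hy).symm, ?_⟩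
  funext i
  simp [Equiv.apply_ofInjective_symm]

section Count

variable {R : Type*} [CommRing R] [IsDomain R] {β : R} {t : Fin N → R}

/-- Uniqueness of the lift is compatible with permutations, so sets of roots correspond to sets of
sites. -/
theorem range_eq_iff_of_leading (ht : ∀ j, IsUnit (1 + β * t j))
    (hd : ∀ i j, i ≠ j → IsUnit (t i - t j)) {y y' : Fin m → PowerSeries R} {f f' : Fin m → Fin N}
    (hy : IsRootsY (const β) PowerSeries.X (fun j => const (t j)) y)
    (hy' : IsRootsY (const β) PowerSeries.X (fun j => const (t j)) y')
    (hf : Function.Injective f) (hf' : Function.Injective f')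
    (hyf : ∀ i, PowerSeries.constantCoeff (y i) = t (f i))
    (hyf' : ∀ i, PowerSeries.constantCoeff (y' i) = t (f' i)) :
    Set.range y = Set.range y' ↔ Set.range f = Set.range f' := by
  constructor
  · intro h
    obtain ⟨σ, rfl⟩ := exists_perm_of_range_eq hy.1 hy'.1 h
    have : f' = f ∘ σ := funext fun i => injective_of_isUnit_sub hd (by
      rw [← hyf', Function.comp_apply, Function.comp_apply, hyf])
    rw [this, EquivLike.range_comp]
  · intro h
    obtain ⟨σ, rfl⟩ := exists_perm_of_range_eq hf hf' h
    have : y' = y ∘ σ := bethe_solution_unique ht hd hy' (hy.comp_perm σ) fun i => by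
      rw [hyf', Function.comp_apply, Function.comp_apply, hyf]
    rw [this, EquivLike.range_comp]

theorem ncard_bethe_solutions (ht : ∀ j, IsUnit (1 + β * t j))
    (hd : ∀ i j, i ≠ j → IsUnit (t i - t j)) (m : ℕ) :
    {S : Set (PowerSeries R) | ∃ y : Fin m → PowerSeries R,
      IsRootsY (const β) PowerSeries.X (fun j => const (t j)) y ∧ Set.range y = S}.ncard =
      N.choose m := by
  have hex : ∀ s : {s : Finset (Fin N) // s.card = m}, ∃ y : Fin m → PowerSeries R,
      IsRootsY (const β) PowerSeries.X (fun j => const (t j)) y ∧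
      ∀ i, PowerSeries.constantCoeff (y i) = t (s.1.orderEmbOfFin s.2 i) := fun s =>
    exists_bethe_solution ht hd (s.1.orderEmbOfFin s.2).injective
  choose y hy hyf using hex
  have : {S : Set (PowerSeries R) | ∃ y : Fin m → PowerSeries R,
      IsRootsY (const β) PowerSeries.X (fun j => const (t j)) y ∧ Set.range y = S} =
      Set.range fun s => Set.range (y s) := by
    ext S
    constructor
    · rintro ⟨y', hy', rfl⟩
      obtain ⟨f, hf, hyf'⟩ := hy'.exists_leading_injective ht hd
      refine ⟨⟨Finset.univ.image f, by rw [Finset.card_image_of_injective _ hf]; simp⟩, ?_⟩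
      refine (range_eq_iff_of_leading ht hd (hy _) hy' (RelEmbedding.injective _) hf (hyf _)
        hyf').2 ?_
      rw [Finset.range_orderEmbOfFin]
      simp
    · rintro ⟨s, rfl⟩
      exact ⟨y s, hy s, rfl⟩
  rw [this, ← Set.image_univ, Set.ncard_image_of_injective, Set.ncard_univ, Nat.card_eq_fintype_card,
    Fintype.card_finset_len, Fintype.card_fin]
  intro s s' h
  have := (range_eq_iff_of_leading ht hd (hy s) (hy s') (RelEmbedding.injective _)
    (RelEmbedding.injective _) (hyf s) (hyf s')).1 h
  rw [Finset.range_orderEmbOfFin, Finset.range_orderEmbOfFin] at this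
  exact Subtype.ext (Finset.coe_injective this)

end Count

/-! ### Bases of Bethe vectors -/

section Basis

variable {A : Type*} [CommRing A]

theorem betheY_comp_perm {β : A} {t : Fin N → A} (ht : ∀ j, IsUnit (1 + β * t j)) {y : Fin m → A}
    (hu : ∀ i, IsUnit (1 + β * y i)) (σ : Equiv.Perm (Fin m)) :
    betheY β t (y ∘ σ) = betheY β t y := by
  rw [betheY, betheY]
  congr 1
  refine List.Perm.prod_eq' ?_ ?_
  · exact ((List.reverse_perm _).trans (Equiv.Perm.ofFn_comp_perm σ
      fun i => mono β t (y i) 0 1)).trans (List.reverse_perm _).symm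
  · rw [List.pairwise_reverse, List.pairwise_ofFn]
    exact fun i j _ => mono_B_commute ht _ _ (hu _)

/-- The coordinates of a family of vectors of weight `n`. -/
def coordMatrix {n : ℕ} (v : {b : Spin N // weight b = n} → Spin N → A) :
    Matrix {b : Spin N // weight b = n} {b : Spin N // weight b = n} A :=
  Matrix.of fun μ b => v μ b.1

/-- Extension by zero of the coordinates of a vector of weight `n`. -/
def extendZero {n : ℕ} (w : {b : Spin N // weight b = n} → A) : Spin N → A :=
  fun b => if h : weight b = n then w ⟨b, h⟩ else 0

theorem extendZero_mem {n : ℕ} (w : {b : Spin N // weight b = n} → A) :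
    extendZero w ∈ weightSpace N n A := by
  refine mem_weightSpace_iff.2 fun b hb => ?_
  by_contra h
  simp [extendZero, h] at hb

theorem eq_of_mem_weightSpace {n : ℕ} {v w : Spin N → A} (hv : v ∈ weightSpace N n A)
    (hw : w ∈ weightSpace N n A) (h : ∀ b : {b : Spin N // weight b = n}, v b.1 = w b.1) :
    v = w := by
  funext b
  by_cases hb : weight b = n
  · exact h ⟨b, hb⟩
  · rw [mem_weightSpace_iff] at hv hw
    rw [by_contra fun h => hb (hv b h), by_contra fun h => hb (hw b h)]

theorem sum_smul_apply_eq_vecMul {n : ℕ} (v : {b : Spin N // weight b = n} → Spin N → A)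
    (c : {b : Spin N // weight b = n} → A) (b : {b : Spin N // weight b = n}) :
    (∑ μ, c μ • v μ) b.1 = (c ᵥ* coordMatrix v) b := by
  simp [Matrix.vecMul, dotProduct, coordMatrix, Finset.sum_apply]

theorem isBasisOf_of_isUnit {n : ℕ} {v : {b : Spin N // weight b = n} → Spin N → A}
    (hv : ∀ μ, v μ ∈ weightSpace N n A) (h : IsUnit (coordMatrix v)) :
    IsBasisOf v (weightSpace N n A) := by
  constructor
  · rw [Fintype.linearIndependent_iff]
    intro c hc
    have : c ᵥ* coordMatrix v = 0 ᵥ* coordMatrix v := by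
      funext b
      rw [← sum_smul_apply_eq_vecMul, hc]
      simp
    exact congrFun (Matrix.vecMul_injective_of_isUnit h this)
  · refine le_antisymm (Submodule.span_le.2 (Set.range_subset_iff.2 hv)) fun w hw => ?_
    obtain ⟨c, hc⟩ := Matrix.vecMul_surjective_iff_isUnit.2 h fun b => w b.1
    refine (Submodule.mem_span_range_iff_exists_fun A).2 ⟨c, ?_⟩
    refine eq_of_mem_weightSpace (Submodule.sum_mem _ fun μ _ => Submodule.smul_mem _ _ (hv μ)) hw
      fun b => ?_
    rw [sum_smul_apply_eq_vecMul]
    exact congrFun hc b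

end Basis

section Unit

variable {R : Type*} [CommRing R] [IsDomain R] {β : R} {t : Fin N → R} {n : ℕ}

/-- By counting, the family meets every `n`-element set of sites, and the order of the roots does
not matter because the B's commute. The family therefore spans, and a square matrix with surjective
action is invertible. -/
theorem isUnit_coordMatrix_inhomogeneities (ht : ∀ j, IsUnit (1 + β * t j))
    (hd : ∀ i j, i ≠ j → IsUnit (t i - t j)) {f : {b : Spin N // weight b = n} → Fin n → Fin N}
    (hf : ∀ μ, Function.Injective (f μ)) (hrange : Function.Injective fun μ => Set.range (f μ)) :
    IsUnit (coordMatrix fun μ => betheY β t fun i => t (f μ i)) := by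
  rw [← Matrix.vecMul_surjective_iff_isUnit]
  intro w
  have hbij : Function.Bijective fun μ => (⟨Finset.univ.image (f μ), by
      rw [Finset.card_image_of_injective _ (hf μ)]; simp⟩ : {s : Finset (Fin N) // s.card = n}) := by
    rw [Fintype.bijective_iff_injective_and_card, card_weight_eq, Fintype.card_finset_len,
      Fintype.card_fin]
    refine ⟨fun μ ν h => hrange ?_, rfl⟩
    have := congrArg (fun s => (s.1 : Set (Fin N))) h
    simpa using this
  have hmem := weightSpace_le_betheSpan ht hd n (extendZero_mem w)
  have hle : betheSpan β t n ≤
      Submodule.span R (Set.range fun μ => betheY β t fun i => t (f μ i)) := by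
    refine Submodule.span_le.2 ?_
    rintro _ ⟨g, hg, rfl⟩
    obtain ⟨μ, hμ⟩ := hbij.2 ⟨Finset.univ.image g, by
      rw [Finset.card_image_of_injective _ hg]; simp⟩
    have hμ' : Set.range (f μ) = Set.range g := by
      have := congrArg (fun s => (s.1 : Set (Fin N))) hμ
      simpa using this
    obtain ⟨σ, rfl⟩ := exists_perm_of_range_eq (hf μ) hg hμ'
    refine Submodule.subset_span ⟨μ, ?_⟩
    exact (betheY_comp_perm ht (fun i => ht (f μ i)) σ).symm
  obtain ⟨c, hc⟩ := (Submodule.mem_span_range_iff_exists_fun R).1 (hle hmem)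
  refine ⟨c, funext fun b => ?_⟩
  refine (sum_smul_apply_eq_vecMul _ c b).symm.trans ?_
  rw [hc, extendZero, dif_pos b.2]

/-- The constant coefficient of the determinant is the determinant at `q = 0`, where the roots are
inhomogeneities. -/
theorem isUnit_coordMatrix (ht : ∀ j, IsUnit (1 + β * t j))
    (hd : ∀ i j, i ≠ j → IsUnit (t i - t j))
    {y : {b : Spin N // weight b = n} → Fin n → PowerSeries R}
    (hy : ∀ μ, IsRootsY (const β) PowerSeries.X (fun j => const (t j)) (y μ))
    (hrange : Function.Injective fun μ => Set.range (y μ)) :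
    IsUnit (coordMatrix fun μ => betheY (const β) (fun j => const (t j)) (y μ)) := by
  choose f hf hyf using fun μ => (hy μ).exists_leading_injective ht hd
  have h₀ := isUnit_coordMatrix_inhomogeneities (β := β) ht hd hf fun μ ν h => hrange
    ((range_eq_iff_of_leading ht hd (hy μ) (hy ν) (hf μ) (hf ν) (hyf μ) (hyf ν)).2 h)
  rw [Matrix.isUnit_iff_isUnit_det, PowerSeries.isUnit_iff_constantCoeff, RingHom.map_det]
  rw [Matrix.isUnit_iff_isUnit_det] at h₀
  convert h₀ using 2
  ext μ b
  simp only [coordMatrix, RingHom.mapMatrix_apply, Matrix.map_apply, Matrix.of_apply]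
  rw [map_betheY _ fun j => isUnit_const (ht j)]
  simp [const, hyf]

end Unit

end

section

variable {A : Type*} [CommRing A] {N m : ℕ}

/-! ### Transposition -/

theorem mpo_mul_eq_mul_mpo {I : Type*} [Fintype I] [DecidableEq I] {Γ : Matrix I I A}
    {ℓ ℓ' : Fin N → Fin 2 → Fin 2 → Matrix I I A} {h : Fin N → Fin 2 → A}
    (hℓ : ∀ j s s', h j s' • (ℓ j s' s * Γ) = h j s • (Γ * ℓ' j s s')) (b b' : Spin N) :
    (∏ j, h j (b' j)) • (mpo ℓ b' b * Γ) = (∏ j, h j (b j)) • (Γ * mpo ℓ' b b') := by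
  induction N with
  | zero => simp [mpo_zero]
  | succ N ih =>
    have h₁ := ih (fun j => hℓ j.succ) (Fin.tail b) (Fin.tail b')
    have h₂ := hℓ 0 (b 0) (b' 0)
    simp only [mpo_succ, Fin.prod_univ_succ, Fin.tail] at h₁ ⊢
    set W := mpo (fun j => ℓ j.succ) (Fin.tail b') (Fin.tail b)
    calc (h 0 (b' 0) * ∏ j : Fin N, h j.succ (b' j.succ)) • (W * ℓ 0 (b' 0) (b 0) * Γ)
        = (∏ j : Fin N, h j.succ (b' j.succ)) • (W * (h 0 (b' 0) • (ℓ 0 (b' 0) (b 0) * Γ))) := by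
          rw [mul_smul_comm, smul_smul, mul_comm, mul_assoc]
      _ = h 0 (b 0) • (((∏ j : Fin N, h j.succ (b' j.succ)) • (W * Γ)) * ℓ' 0 (b 0) (b' 0)) := by
          rw [h₂, mul_smul_comm, smul_comm, smul_mul_assoc, mul_assoc]
      _ = _ := by
          rw [h₁, smul_mul_assoc, smul_smul, mul_assoc]

/-- The diagonal operator which relates the transposed model to the model with reversed sites. -/
def gauge (β : A) (t : Fin N → A) (b : Spin N) : A := ∏ j, (1 + β * t j) ^ (b j : ℕ)

theorem isUnit_gauge {β : A} {t : Fin N → A} (ht : ∀ j, IsUnit (1 + β * t j)) (b : Spin N) :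
    IsUnit (gauge β t b) := by
  rw [gauge, IsUnit.prod_univ_iff]
  exact fun j => (ht j).pow _

theorem one_add_ominus {β x t : A} (ht : IsUnit (1 + β * t)) :
    (1 + β * ominus β x t) * (1 + β * t) = 1 + β * x := by
  have := Ring.inverse_mul_cancel _ ht
  rw [ominus]
  linear_combination β * (x - t) * this

/-- Locally, transposition in both spaces only moves the factor `1 + β (x ⊖ t_j) = (1 + β x) / (1 +
β t_j)` from one off-diagonal entry to the other. Its numerator is absorbed by a diagonal matrix on
the auxiliary space, its denominator by the gauge on the quantum space. -/
theorem mono_transpose {β : A} {t : Fin N → A} (ht : ∀ j, IsUnit (1 + β * t j)) (x : A)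
    (b b' : Spin N) (a c : Fin 2) :
    gauge β t b' * (mono β t x c a b' b * (1 + β * x) ^ (c : ℕ)) =
      gauge β t b * ((1 + β * x) ^ (a : ℕ) *
        mono β (t ∘ Fin.rev) x a c (b ∘ Fin.rev) (b' ∘ Fin.rev)) := by
  have hg : ∀ b : Spin N,
      gauge β t b = ∏ j : Fin N, (1 + β * t j.rev) ^ ((b ∘ Fin.rev) j : ℕ) := fun b =>
    (Equiv.prod_comp Fin.revPerm fun j => (1 + β * t j) ^ (b j : ℕ)).symm
  have h := mpo_mul_eq_mul_mpo (Γ := Matrix.diagonal fun a : Fin 2 => (1 + β * x) ^ (a : ℕ))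
    (ℓ := fun j s s' => (cell β (ominus β x (t j.rev)) s s')ᵀ)
    (ℓ' := fun j => cell β (ominus β x (t j.rev)))
    (h := fun j s => (1 + β * t j.rev) ^ (s : ℕ)) (fun j s s' => by
      have hx := one_add_ominus (x := x) (ht j.rev)
      rw [← hx]
      ext a c
      fin_cases s <;> fin_cases s' <;> fin_cases a <;> fin_cases c <;> simp [cell] <;> ring)
    (b ∘ Fin.rev) (b' ∘ Fin.rev)
  have h' := congrFun (congrFun h a) c
  rw [mpo_rev fun j => cell β (ominus β x (t j))] at h'
  simp only [Matrix.smul_apply, Matrix.mul_diagonal, Matrix.diagonal_mul, ← hg, smul_eq_mul,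
    Matrix.transpose_apply] at h'
  simpa only [mono_apply, Function.comp_apply] using h'

theorem transferH_transpose {β : A} {t : Fin N → A} (ht : ∀ j, IsUnit (1 + β * t j)) (q : A) {x : A}
    (hx : IsUnit (1 + β * x)) (b b' : Spin N) :
    gauge β t b' * transferH β q t x b' b =
      gauge β t b * transferH β q (t ∘ Fin.rev) x (b ∘ Fin.rev) (b' ∘ Fin.rev) := by
  have h₀ := mono_transpose ht x b b' 0 0
  have h₁ := mono_transpose ht x b b' 1 1
  simp only [Fin.val_zero, Fin.val_one, pow_zero, pow_one, mul_one, one_mul] at h₀ h₁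
  have h₁' : gauge β t b' * mono β t x 1 1 b' b = gauge β t b *
      mono β (t ∘ Fin.rev) x 1 1 (b ∘ Fin.rev) (b' ∘ Fin.rev) :=
    hx.mul_left_cancel (by linear_combination h₁)
  simp only [transferH, Matrix.add_apply, Matrix.smul_apply, smul_eq_mul]
  linear_combination h₀ + q * h₁'

theorem betheY_zero (β : A) (t : Fin N → A) (y : Fin 0 → A) :
    betheY β t y = Pi.single (fun _ => 0) 1 := by
  rw [betheY, List.ofFn_zero, List.reverse_nil, List.prod_nil, one_mulVec]

theorem dualBetheY_succ (β : A) (t : Fin N → A) (y : Fin (m + 1) → A) :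
    dualBetheY β t y = dualBetheY β t (fun i => y i.succ) ᵥ* mono β t (y 0) 1 0 := by
  rw [dualBetheY, dualBetheY, List.ofFn_succ, List.reverse_cons, List.prod_append,
    List.prod_singleton, vecMul_vecMul]

theorem dualBetheY_eq {β : A} {t : Fin N → A} (ht : ∀ j, IsUnit (1 + β * t j)) (y : Fin m → A)
    (b : Spin N) :
    (∏ i, (1 + β * y i)) * dualBetheY β t y b =
      gauge β t b * betheY β (t ∘ Fin.rev) (y ∘ Fin.rev) (b ∘ Fin.rev) := by
  induction m generalizing b with
  | zero =>
    rw [betheY_zero]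
    have : (b ∘ Fin.rev = fun _ => 0) ↔ b = fun _ => 0 := by
      refine ⟨fun h => ?_, fun h => by subst h; rfl⟩
      rw [← Function.comp_id b, ← Fin.rev_involutive.comp_self, ← Function.comp_assoc, h]
      rfl
    by_cases hb : b = fun _ => 0
    · subst hb
      simp [dualBetheY, gauge, Function.comp_def]
    · simp [dualBetheY, this, hb]
  | succ m ih =>
    have hr : (fun i : Fin m => (y ∘ Fin.rev) i.castSucc) = (fun i => y i.succ) ∘ Fin.rev := by
      funext i
      simp [Fin.rev_castSucc]
    have hl : (y ∘ Fin.rev) (Fin.last m) = y 0 := by simp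
    rw [dualBetheY_succ, betheY_snoc, hr, hl, Fin.prod_univ_succ]
    simp only [Matrix.vecMul, Matrix.mulVec, dotProduct, Finset.mul_sum]
    rw [← Equiv.sum_comp (Equiv.arrowCongr Fin.revPerm (Equiv.refl (Fin 2)))
      fun b' => gauge β t b * (_ * betheY β (t ∘ Fin.rev) ((fun i => y i.succ) ∘ Fin.rev) b')]
    refine Finset.sum_congr rfl fun b' _ => ?_
    have h := mono_transpose ht (y 0) b b' 0 1
    simp only [Fin.val_zero, Fin.val_one, pow_zero, pow_one, one_mul] at h
    have hb' : (Equiv.arrowCongr Fin.revPerm (Equiv.refl (Fin 2))) b' = b' ∘ Fin.rev := rfl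
    rw [hb']
    linear_combination (1 + β * y 0) * mono β t (y 0) 1 0 b' b * ih (fun i => y i.succ) b' +
      betheY β (t ∘ Fin.rev) ((fun i => y i.succ) ∘ Fin.rev) (b' ∘ Fin.rev) * h

/-- Transposed right eigenvectors of the reversed model are left eigenvectors, once the gauge is
undone. -/
theorem vecMul_eq_smul_of_transpose {K : Type*} [Field K] {T T' : Op N K} {h : Spin N → K}
    {v w : Spin N → K} {c Λ : K}
    (hc : c ≠ 0) (hT : ∀ b b', h b' * T b' b = h b * T' (b ∘ Fin.rev) (b' ∘ Fin.rev))
    (hw : ∀ b, c * w b = h b * v (b ∘ Fin.rev)) (hv : T' *ᵥ v = Λ • v) : w ᵥ* T = Λ • w := by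
  funext b
  apply mul_left_cancel₀ hc
  have h₁ := congrFun hv (b ∘ Fin.rev)
  simp only [Pi.smul_apply, smul_eq_mul] at h₁ ⊢
  rw [mul_left_comm, hw, mul_left_comm, ← h₁]
  simp only [Matrix.vecMul, Matrix.mulVec, dotProduct, Finset.mul_sum]
  rw [← Equiv.sum_comp (Equiv.arrowCongr Fin.revPerm (Equiv.refl (Fin 2)))
      fun b' => h b * (T' (b ∘ Fin.rev) b' * v b')]
  refine Finset.sum_congr rfl fun b' _ => ?_
  have hb' : (Equiv.arrowCongr Fin.revPerm (Equiv.refl (Fin 2))) b' = b' ∘ Fin.rev := rfl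
  rw [hb']
  linear_combination T b' b * hw b' + v (b' ∘ Fin.rev) * hT b b'

/-! ### Particle-hole duality -/

/-- Reversal of the order of the sites and exchange of the letters `0` and `1`. -/
def hole : Spin N ≃ Spin N where
  toFun b j := (b j.rev).rev
  invFun b j := (b j.rev).rev
  left_inv b := by funext j; simp
  right_inv b := by funext j; simp

theorem hole_apply (b : Spin N) (j : Fin N) : hole b j = (b j.rev).rev := rfl

theorem hole_hole (b : Spin N) : hole (hole b) = b := hole.left_inv b

theorem weight_hole (b : Spin N) : weight (hole b) + weight b = N := by
  have : weight b = ∑ j : Fin N, (b j.rev : ℕ) :=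
    (Equiv.sum_comp Fin.revPerm fun j => (b j : ℕ)).symm
  rw [this, weight, ← Finset.sum_add_distrib]
  rw [Finset.sum_congr rfl fun j _ => show (hole b j : ℕ) + b j.rev = 1 by
    rw [hole_apply, Fin.val_rev]; omega]
  simp

/-- The inhomogeneities `⊖ t_j` in reversed order. -/
def dualParam (β : A) (t : Fin N → A) (j : Fin N) : A := ominus β 0 (t j.rev)

theorem one_add_dual {β t : A} (ht : IsUnit (1 + β * t)) :
    (1 + β * ominus β 0 t) * (1 + β * t) = 1 := by
  rw [one_add_ominus ht]; ring

theorem isUnit_dualParam {β : A} {t : Fin N → A} (ht : ∀ j, IsUnit (1 + β * t j)) (j : Fin N) :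
    IsUnit (1 + β * dualParam β t j) :=
  IsUnit.of_mul_eq_one _ (one_add_dual (ht j.rev))

theorem ominus_dual {β x t : A} (ht : IsUnit (1 + β * t)) :
    ominus β x (ominus β 0 t) = oplus β x t := by
  have h := one_add_dual ht
  have hu : IsUnit (1 + β * ominus β 0 t) := IsUnit.of_mul_eq_one _ h
  have hi : Ring.inverse (1 + β * ominus β 0 t) = 1 + β * t := by
    apply hu.mul_left_cancel
    rw [Ring.mul_inverse_cancel _ hu, h]
  have := Ring.inverse_mul_cancel _ ht
  rw [ominus, hi, ominus, oplus]
  linear_combination t * this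

theorem dualParam_dualParam {β : A} {t : Fin N → A} (ht : ∀ j, IsUnit (1 + β * t j)) :
    dualParam β (dualParam β t) = t := by
  funext j
  rw [dualParam, dualParam, ominus_dual (by simpa using ht j), Fin.rev_rev, oplus]
  ring

theorem isUnit_dualParam_sub {β : A} {t : Fin N → A} (ht : ∀ j, IsUnit (1 + β * t j))
    (hd : ∀ i j, i ≠ j → IsUnit (t i - t j)) (i j : Fin N) (hij : i ≠ j) :
    IsUnit (dualParam β t i - dualParam β t j) := by
  have h := hd j.rev i.rev (Fin.rev_injective.ne hij.symm)
  have hi := Ring.inverse_mul_cancel _ (ht i.rev)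
  have hj := Ring.inverse_mul_cancel _ (ht j.rev)
  have : dualParam β t i - dualParam β t j = (t j.rev - t i.rev) *
      Ring.inverse (1 + β * t i.rev) * Ring.inverse (1 + β * t j.rev) := by
    rw [dualParam, dualParam, ominus, ominus]
    linear_combination t i.rev * Ring.inverse (1 + β * t i.rev) * hj -
      t j.rev * Ring.inverse (1 + β * t j.rev) * hi
  rw [this]
  exact (h.mul (isUnit_ringInverse (ht i.rev))).mul (isUnit_ringInverse (ht j.rev))

/-- Flipping the spins turns the local tensors of `L` into the auxiliary transposes of those of
`L'`, because `x ⊖ (⊖ t) = x ⊕ t`. The transposition reverses the order of sites, which `hole` and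
`dualParam` compensate. -/
theorem mono'_eq_mono {β : A} {t : Fin N → A} (ht : ∀ j, IsUnit (1 + β * t j)) (x : A)
    (a c : Fin 2) (b b' : Spin N) :
    mono' β t x a c b b' = mono β (dualParam β t) x c a (hole b) (hole b') := by
  have h := mpo_rev (fun j => cell β (ominus β x (dualParam β t j))) (hole b) (hole b')
  rw [mono_apply, mono'_apply, ← Matrix.transpose_apply (mpo _ (hole b) (hole b')), ← h]
  refine congrFun (congrFun ?_ a) c
  rw [mpo, mpo]
  congr 3
  funext j
  simp only [dualParam, Fin.rev_rev, ominus_dual (ht j), Function.comp_apply, hole_apply]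
  generalize b j = s
  generalize b' j = s'
  ext a c
  fin_cases s <;> fin_cases s' <;> fin_cases a <;> fin_cases c <;> simp [cell, cell']

theorem transferE_eq {β : A} {t : Fin N → A} (ht : ∀ j, IsUnit (1 + β * t j)) (q x : A)
    (b b' : Spin N) :
    transferE β q t x b b' = transferH β q (dualParam β t) x (hole b) (hole b') := by
  simp only [transferE, transferH, Matrix.add_apply, Matrix.smul_apply, mono'_eq_mono ht]

theorem transferH_eq {β : A} {t : Fin N → A} (ht : ∀ j, IsUnit (1 + β * t j)) (q x : A)
    (b b' : Spin N) :
    transferH β q t x b b' = transferE β q (dualParam β t) x (hole b) (hole b') := by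
  rw [transferE_eq (isUnit_dualParam ht), dualParam_dualParam ht, hole_hole, hole_hole]

theorem mulVec_hole {T T' : Op N A} (h : ∀ b b', T b b' = T' (hole b) (hole b'))
    {v v' : Spin N → A} (hv : ∀ b, v b = v' (hole b)) (b : Spin N) :
    (T *ᵥ v) b = (T' *ᵥ v') (hole b) := by
  simp only [Matrix.mulVec, dotProduct, h, hv]
  exact Equiv.sum_comp hole fun b' => T' (hole b) b' * v' b'

theorem vecMul_hole {T T' : Op N A} (h : ∀ b b', T b b' = T' (hole b) (hole b'))
    {v v' : Spin N → A} (hv : ∀ b, v b = v' (hole b)) (b : Spin N) :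
    (v ᵥ* T) b = (v' ᵥ* T') (hole b) := by
  simp only [Matrix.vecMul, dotProduct, h, hv]
  exact Equiv.sum_comp hole fun b' => v' b' * T' b' (hole b)

theorem single_one_apply (b : Spin N) :
    (Pi.single (fun _ => 1) 1 : Spin N → A) b =
      (Pi.single (fun _ => 0) 1 : Spin N → A) (hole b) := by
  have : hole b = (fun _ => 0) ↔ b = fun _ => 1 := by
    rw [← Equiv.eq_symm_apply]
    exact iff_of_eq (congrArg (b = ·) (funext fun j => rfl))
  simp [Pi.single_apply, this]

theorem betheZ_snoc (β : A) (t : Fin N → A) (z : Fin (m + 1) → A) :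
    betheZ β t z = mono' β t (z (Fin.last m)) 1 0 *ᵥ betheZ β t (fun i => z i.castSucc) := by
  rw [betheZ, betheZ, List.ofFn_succ', List.concat_eq_append, List.reverse_append,
    List.reverse_singleton, List.singleton_append, List.prod_cons, mulVec_mulVec]

theorem dualBetheZ_succ (β : A) (t : Fin N → A) (z : Fin (m + 1) → A) :
    dualBetheZ β t z = dualBetheZ β t (fun i => z i.succ) ᵥ* mono' β t (z 0) 0 1 := by
  rw [dualBetheZ, dualBetheZ, List.ofFn_succ, List.reverse_cons, List.prod_append,
    List.prod_singleton, vecMul_vecMul]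

theorem betheZ_eq {β : A} {t : Fin N → A} (ht : ∀ j, IsUnit (1 + β * t j)) (z : Fin m → A)
    (b : Spin N) : betheZ β t z b = betheY β (dualParam β t) z (hole b) := by
  induction m generalizing b with
  | zero =>
    rw [betheY_zero, betheZ, List.ofFn_zero, List.reverse_nil, List.prod_nil, one_mulVec,
      single_one_apply]
  | succ m ih =>
    rw [betheY_snoc, betheZ_snoc]
    exact mulVec_hole (mono'_eq_mono ht _ 1 0) (ih _) b

theorem dualBetheZ_eq {β : A} {t : Fin N → A} (ht : ∀ j, IsUnit (1 + β * t j)) (z : Fin m → A)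
    (b : Spin N) : dualBetheZ β t z b = dualBetheY β (dualParam β t) z (hole b) := by
  induction m generalizing b with
  | zero =>
    rw [dualBetheY, dualBetheZ, List.ofFn_zero, List.ofFn_zero, List.reverse_nil, List.prod_nil,
      vecMul_one, vecMul_one, single_one_apply]
  | succ m ih =>
    rw [dualBetheY_succ, dualBetheZ_succ]
    exact vecMul_hole (mono'_eq_mono ht _ 0 1) (ih _) b

theorem prod_oplus_eq {β : A} {t : Fin N → A} (ht : ∀ j, IsUnit (1 + β * t j)) (x : A) :
    ∏ j, oplus β x (t j) = ∏ j, ominus β x (dualParam β t j) := by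
  rw [← Equiv.prod_comp Fin.revPerm fun j => ominus β x (dualParam β t j)]
  exact Finset.prod_congr rfl fun j _ => by simp [dualParam, ominus_dual (ht j)]

theorem isRootsZ_iff {β q : A} {t : Fin N → A} (ht : ∀ j, IsUnit (1 + β * t j)) (z : Fin m → A) :
    IsRootsZ β q t z ↔ IsRootsY β q (dualParam β t) z := by
  simp only [IsRootsZ, IsRootsY, prod_oplus_eq ht]

theorem eigenvalueE_eq {K : Type*} [Field K] {β q : K} {t : Fin N → K}
    (ht : ∀ j, IsUnit (1 + β * t j)) (x : K) (z : Fin m → K) :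
    eigenvalueE β q t x z = eigenvalueH β q (dualParam β t) x z := by
  rw [eigenvalueE, eigenvalueH, prod_oplus_eq ht]

theorem map_dualParam {A' : Type*} [CommRing A'] (φ : A →+* A') {β : A} {t : Fin N → A}
    (ht : ∀ j, IsUnit (1 + β * t j)) (j : Fin N) :
    φ (dualParam β t j) = dualParam (φ β) (fun j => φ (t j)) j := by
  rw [dualParam, dualParam, map_ominus φ _ _ _ (ht _), map_zero]

theorem IsRootsY.comp_rev {β q : A} {t : Fin N → A} {y : Fin m → A} (hy : IsRootsY β q t y) :
    IsRootsY β q (t ∘ Fin.rev) (y ∘ Fin.rev) := by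
  have h := hy.comp_perm Fin.revPerm
  refine ⟨h.1, h.2.1, fun i => ?_⟩
  have := h.2.2 i
  rw [← Equiv.prod_comp Fin.revPerm fun j => ominus β _ (t j)] at this
  exact this

theorem eigenvalueH_comp_rev {K : Type*} [Field K] (β q : K) (t : Fin N → K)
    (x : K) (y : Fin m → K) :
    eigenvalueH β q (t ∘ Fin.rev) x (y ∘ Fin.rev) = eigenvalueH β q t x y := by
  rw [eigenvalueH, eigenvalueH, ← Equiv.prod_comp Fin.revPerm fun j => ominus β x (t j),
    ← Equiv.prod_comp Fin.revPerm fun i => 1 + β * ominus β x (y i),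
    ← Equiv.prod_comp Fin.revPerm fun i => ominus β x (y i)]
  rfl

end

section

variable {N m n : ℕ}

/-! ### Simultaneous eigenvectors -/

theorem mulVec_mem_weightSpace {A : Type*} [CommRing A] {T : Op N A}
    (hT : ∀ b b', T b b' ≠ 0 → weight b = weight b') {v : Spin N → A}
    (hv : v ∈ weightSpace N n A) : T *ᵥ v ∈ weightSpace N n A := by
  rw [mem_weightSpace_iff] at hv ⊢
  intro b hb
  obtain ⟨b', -, he⟩ := Finset.exists_ne_zero_of_sum_ne_zero hb
  rw [hT b b' (left_ne_zero_of_mul he), hv b' (right_ne_zero_of_mul he)]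

theorem vecMul_mem_weightSpace {A : Type*} [CommRing A] {T : Op N A}
    (hT : ∀ b b', T b b' ≠ 0 → weight b = weight b') {v : Spin N → A}
    (hv : v ∈ weightSpace N n A) : v ᵥ* T ∈ weightSpace N n A := by
  rw [mem_weightSpace_iff] at hv ⊢
  intro b hb
  obtain ⟨b', -, he⟩ := Finset.exists_ne_zero_of_sum_ne_zero hb
  rw [← hT b' b (right_ne_zero_of_mul he), hv b' (left_ne_zero_of_mul he)]

theorem weight_transferE {A : Type*} [CommRing A] {β q : A} {t : Fin N → A} {x : A} {b b' : Spin N}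
    (h : transferE β q t x b b' ≠ 0) : weight b = weight b' := by
  by_contra hne
  refine h ?_
  have h₀ : mono' β t x 0 0 b b' = 0 := by_contra fun h => hne (by simpa using weight_mono' h)
  have h₁ : mono' β t x 1 1 b b' = 0 := by_contra fun h => hne (by simpa using weight_mono' h)
  simp only [transferE, Matrix.add_apply, Matrix.smul_apply, h₀, h₁, smul_zero, add_zero]

/-- An operator commuting with one of simple spectrum preserves its eigenlines. The left vectors
have the same eigenvalue because `w μ` is orthogonal to all `v ν` with `ν ≠ μ`. -/
theorem exists_common_eigenvalue {K ι : Type*} [Field K] [Fintype ι] {H E : Op N K}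
    (hHE : Commute H E) {v w : ι → Spin N → K} {Λ : ι → K} (hΛ : Function.Injective Λ)
    (hv : IsBasisOf v (weightSpace N n K)) (hw : ∀ μ, w μ ∈ weightSpace N n K)
    (hHv : ∀ μ, H *ᵥ v μ = Λ μ • v μ) (hHw : ∀ μ, w μ ᵥ* H = Λ μ • w μ)
    (hE : ∀ b b', E b b' ≠ 0 → weight b = weight b') (μ : ι) :
    ∃ ε, IsEigenpair E (v μ) (w μ) ε := by
  have hvmem : ∀ μ, v μ ∈ weightSpace N n K := fun μ => by
    rw [← hv.2]; exact Submodule.subset_span ⟨μ, rfl⟩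
  have hright : ∀ μ, ∃ ε : K, E *ᵥ v μ = ε • v μ := by
    intro μ
    have hmem := mulVec_mem_weightSpace hE (hvmem μ)
    rw [← hv.2, Submodule.mem_span_range_iff_exists_fun] at hmem
    obtain ⟨c, hc⟩ := hmem
    have h₁ : H *ᵥ (E *ᵥ v μ) = Λ μ • (E *ᵥ v μ) := by
      rw [mulVec_mulVec, hHE.eq, ← mulVec_mulVec, hHv, mulVec_smul]
    have h₂ : ∑ ν, (c ν * (Λ ν - Λ μ)) • v ν = 0 := by
      rw [← hc, mulVec_sum, Finset.smul_sum] at h₁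
      rw [← sub_eq_zero.2 h₁, ← Finset.sum_sub_distrib]
      refine Finset.sum_congr rfl fun ν _ => ?_
      rw [mulVec_smul, hHv, smul_smul, smul_smul, ← sub_smul]
      congr 1
      ring
    have h₃ := Fintype.linearIndependent_iff.1 hv.1 _ h₂
    refine ⟨c μ, ?_⟩
    rw [← hc]
    refine Finset.sum_eq_single μ (fun ν _ hν => ?_) (fun h => (h (Finset.mem_univ μ)).elim)
    rw [(mul_eq_zero.1 (h₃ ν)).resolve_right (sub_ne_zero.2 (hΛ.ne hν)), zero_smul]
  choose ε hε using hright
  have horth : ∀ ν, ν ≠ μ → w μ ⬝ᵥ v ν = 0 := by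
    intro ν hν
    have h := dotProduct_mulVec (w μ) H (v ν)
    rw [hHv, hHw, dotProduct_smul, smul_dotProduct, smul_eq_mul, smul_eq_mul, ← sub_eq_zero,
      ← sub_mul] at h
    exact (mul_eq_zero.1 h).resolve_left (sub_ne_zero.2 (hΛ.ne hν))
  refine ⟨ε μ, hε μ, ?_⟩
  -- The defect of the left eigenvalue equation pairs to zero with every `v ν`, hence with the whole
  -- weight space, in which it lies.
  set u := w μ ᵥ* E - ε μ • w μ with hu
  have humem : u ∈ weightSpace N n K :=
    Submodule.sub_mem _ (vecMul_mem_weightSpace hE (hw μ)) (Submodule.smul_mem _ _ (hw μ))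
  have huv : ∀ ν, u ⬝ᵥ v ν = 0 := by
    intro ν
    rw [hu, sub_dotProduct, ← dotProduct_mulVec, hε, dotProduct_smul, smul_dotProduct]
    by_cases h : ν = μ
    · rw [h, sub_self]
    · rw [horth ν h, smul_zero, smul_zero, sub_zero]
  have hall : ∀ v' ∈ weightSpace N n K, u ⬝ᵥ v' = 0 := by
    intro v' hv'
    rw [← hv.2] at hv'
    induction hv' using Submodule.span_induction with
    | mem v' h => obtain ⟨ν, rfl⟩ := h; exact huv ν
    | zero => exact dotProduct_zero u
    | add a b _ _ ha hb => rw [dotProduct_add, ha, hb, add_zero]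
    | smul a b _ hb => rw [dotProduct_smul, hb, smul_zero]
  refine sub_eq_zero.1 (eq_of_mem_weightSpace humem (Submodule.zero_mem _) fun b => ?_)
  have := hall _ (Submodule.subset_span ⟨b.1, b.2, rfl⟩)
  rw [dotProduct_single, mul_one] at this
  exact this

/-! ### On-shell Bethe vectors -/

theorem IsRootsY.map {A A' : Type*} [CommRing A] [CommRing A'] (φ : A →+* A')
    (hφ : Function.Injective φ) {β q : A} {t : Fin N → A} (ht : ∀ j, IsUnit (1 + β * t j))
    {y : Fin m → A} (hy : IsRootsY β q t y) :
    IsRootsY (φ β) (φ q) (fun j => φ (t j)) (fun i => φ (y i)) := by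
  refine ⟨hφ.comp hy.1, fun i => by simpa using (hy.2.1 i).map φ, fun i => ?_⟩
  have := congrArg φ (hy.2.2 i)
  simpa only [map_add, map_mul, map_pow, map_neg, map_one, map_zero, map_prod,
    map_ringInverse φ (hy.2.1 i), map_ominus φ _ _ _ (ht _)] using this

variable {R : Type*} [CommRing R] [IsDomain R]

theorem incl_injective : Function.Injective (incl R) :=
  (IsFractionRing.injective (Polynomial (PowerSeries R)) (SpecField R)).comp Polynomial.C_injective

/-- The value `x + s` of the spectral parameter. -/
def specShift (s : PowerSeries R) : SpecField R :=
  algebraMap (Polynomial (PowerSeries R)) (SpecField R) (Polynomial.X + Polynomial.C s)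

theorem specShift_zero : specShift (0 : PowerSeries R) = specX R := by
  simp [specShift, specX]

theorem specShift_ne_incl (s y : PowerSeries R) : specShift s ≠ incl R y := by
  intro h
  have := congrArg (Polynomial.coeff · 1)
    (IsFractionRing.injective (Polynomial (PowerSeries R)) (SpecField R) h)
  simp at this

theorem one_add_mul_specShift_ne_zero (β s : PowerSeries R) :
    1 + incl R β * specShift s ≠ 0 := by
  have h : 1 + incl R β * specShift s = algebraMap (Polynomial (PowerSeries R)) (SpecField R)
      (1 + Polynomial.C β * (Polynomial.X + Polynomial.C s)) := by
    simp [incl, specShift]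
  rw [h]
  intro h0
  have := congrArg (Polynomial.eval (-s))
    (IsFractionRing.injective (Polynomial (PowerSeries R)) (SpecField R)
      (h0.trans (map_zero _).symm))
  simp at this

/-- The shift by `1` is what makes this hold in general: `x ⊕ x` is zero in characteristic two with
`β = 0`, whereas `(x + 1) ⊕ x` takes the value `1` at `x = 0`. -/
theorem oplus_specShift_ne_zero (β : PowerSeries R) :
    oplus (incl R β) (specShift 1) (specX R) ≠ 0 := by
  have h : oplus (incl R β) (specShift 1) (specX R) =
      algebraMap (Polynomial (PowerSeries R)) (SpecField R)
      (Polynomial.X + Polynomial.C 1 + Polynomial.X +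
        Polynomial.C β * (Polynomial.X + Polynomial.C 1) * Polynomial.X) := by
    simp [oplus, incl, specShift, specX]
  rw [h]
  intro h0
  have := congrArg (Polynomial.eval 0)
    (IsFractionRing.injective (Polynomial (PowerSeries R)) (SpecField R)
      (h0.trans (map_zero _).symm))
  simp at this

section OnShell

variable {β : R} {t : Fin N → R}

theorem incl_param_ne_zero (ht : ∀ j, IsUnit (1 + β * t j)) (j : Fin N) :
    1 + incl R (const β) * incl R (const (t j)) ≠ 0 := by
  simpa using ((isUnit_const (ht j)).map (incl R)).ne_zero

theorem extend_betheY (ht : ∀ j, IsUnit (1 + β * t j)) (y : Fin m → PowerSeries R) :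
    extend (betheY (const β) (fun j => const (t j)) y) =
      betheY (incl R (const β)) (fun j => incl R (const (t j))) (fun i => incl R (y i)) :=
  funext fun b => map_betheY (incl R) (fun j => isUnit_const (ht j)) y b

theorem transferH_mulVec_extend (ht : ∀ j, IsUnit (1 + β * t j)) {y : Fin m → PowerSeries R}
    (hy : IsRootsY (const β) PowerSeries.X (fun j => const (t j)) y) (s : PowerSeries R) :
    transferH (incl R (const β)) (incl R PowerSeries.X) (fun j => incl R (const (t j)))
        (specShift s) *ᵥ extend (betheY (const β) (fun j => const (t j)) y) =
      eigenvalueH (incl R (const β)) (incl R PowerSeries.X) (fun j => incl R (const (t j)))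
        (specShift s) (fun i => incl R (y i)) •
          extend (betheY (const β) (fun j => const (t j)) y) := by
  rw [extend_betheY ht]
  exact transferH_mulVec_betheY (incl_param_ne_zero ht)
    (hy.map (incl R) incl_injective fun j => isUnit_const (ht j))
    (one_add_mul_specShift_ne_zero _ _) fun i => specShift_ne_incl _ _

/-- The right eigenvector equation for reversed inhomogeneities and roots is transposed; the
eigenvalue is symmetric in both. -/
theorem extend_vecMul_transferH (ht : ∀ j, IsUnit (1 + β * t j)) {y : Fin m → PowerSeries R}
    (hy : IsRootsY (const β) PowerSeries.X (fun j => const (t j)) y) (s : PowerSeries R) :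
    extend (dualBetheY (const β) (fun j => const (t j)) y) ᵥ*
        transferH (incl R (const β)) (incl R PowerSeries.X) (fun j => incl R (const (t j)))
          (specShift s) =
      eigenvalueH (incl R (const β)) (incl R PowerSeries.X) (fun j => incl R (const (t j)))
        (specShift s) (fun i => incl R (y i)) •
          extend (dualBetheY (const β) (fun j => const (t j)) y) := by
  have hu : IsUnit (∏ i, (1 + const β * y i)) := by
    rw [IsUnit.prod_univ_iff]; exact hy.2.1
  have h := transferH_mulVec_extend (t := t ∘ Fin.rev) (fun j => ht j.rev) hy.comp_rev s
  have hT := transferH_transpose (fun j => (incl_param_ne_zero ht j).isUnit) (incl R PowerSeries.X)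
    (one_add_mul_specShift_ne_zero (const β) s).isUnit
  have hw : ∀ b, incl R (∏ i, (1 + const β * y i)) *
      extend (dualBetheY (const β) (fun j => const (t j)) y) b =
      gauge (incl R (const β)) (fun j => incl R (const (t j))) b *
        extend (betheY (const β) (fun j => const ((t ∘ Fin.rev) j)) (y ∘ Fin.rev))
          (b ∘ Fin.rev) := by
    intro b
    have := congrArg (incl R) (dualBetheY_eq (fun j => isUnit_const (ht j)) y b)
    rw [map_mul, map_mul] at this
    rw [extend, extend, this]
    congr 1
    simp only [gauge, map_prod, map_pow, map_add, map_one, map_mul]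
  rw [← eigenvalueH_comp_rev]
  exact vecMul_eq_smul_of_transpose (hu.map (incl R)).ne_zero hT hw h

theorem isEigenpair_specH (ht : ∀ j, IsUnit (1 + β * t j)) {y : Fin m → PowerSeries R}
    (hy : IsRootsY (const β) PowerSeries.X (fun j => const (t j)) y) :
    IsEigenpair (specH β t) (extend (betheY (const β) (fun j => const (t j)) y))
      (extend (dualBetheY (const β) (fun j => const (t j)) y)) (onShellH β t y) := by
  have h₁ := transferH_mulVec_extend ht hy 0
  have h₂ := extend_vecMul_transferH ht hy 0
  rw [specShift_zero] at h₁ h₂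
  exact ⟨h₁, h₂⟩

theorem eigenvalueH_eq {K : Type*} [Field K] {β q : K} {t : Fin N → K} (ht : ∀ j, 1 + β * t j ≠ 0)
    {y : Fin m → K} (hy : ∀ i, 1 + β * y i ≠ 0) {x : K} (hxy : ∀ i, x ≠ y i) :
    eigenvalueH β q t x y * ((∏ j, (1 + β * t j)) * ∏ i, (x - y i)) =
      (∏ i, (1 + β * y i)) * ∏ j, (x - t j) +
        (-1) ^ m * q * (∏ j, (1 + β * t j)) * (1 + β * x) ^ m := by
  have h1 : ∏ i, ominus β x (y i) = ∏ i, ((x - y i) / (1 + β * y i)) := by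
    simp [ominus, Ring.inverse_eq_inv', div_eq_mul_inv]
  have h1' : ∏ j, ominus β x (t j) = ∏ j, ((x - t j) / (1 + β * t j)) := by
    simp [ominus, Ring.inverse_eq_inv', div_eq_mul_inv]
  have h2 : ∏ i, (1 + β * ominus β x (y i)) = ∏ i, ((1 + β * x) / (1 + β * y i)) := by
    refine Finset.prod_congr rfl fun i _ => ?_
    rw [eq_div_iff (hy i), one_add_ominus (hy i).isUnit]
  have h3 : ∏ i, (x - y i) ≠ 0 := Finset.prod_ne_zero_iff.2 fun i _ => sub_ne_zero.2 (hxy i)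
  have h4 : ∏ i, (1 + β * y i) ≠ 0 := Finset.prod_ne_zero_iff.2 fun i _ => hy i
  have h5 : ∏ j, (1 + β * t j) ≠ 0 := Finset.prod_ne_zero_iff.2 fun i _ => ht i
  rw [eigenvalueH, h1, h1', h2]
  simp only [Finset.prod_div_distrib, Finset.prod_const, Finset.card_univ, Fintype.card_fin]
  field_simp

/-- Simplicity of the spectrum. Cross-multiplying the eigenvalues and setting `q = 0` leaves an
identity between polynomials whose zeros, shifted by `s`, are the leading terms of the two families
of roots. -/
theorem range_subset_of_eigenvalueH_eq (ht : ∀ j, IsUnit (1 + β * t j))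
    (hd : ∀ i j, i ≠ j → IsUnit (t i - t j)) {y y' : Fin m → PowerSeries R} {f f' : Fin m → Fin N}
    (hy : IsRootsY (const β) PowerSeries.X (fun j => const (t j)) y)
    (hy' : IsRootsY (const β) PowerSeries.X (fun j => const (t j)) y')
    (hyf : ∀ i, PowerSeries.constantCoeff (y i) = t (f i))
    (hyf' : ∀ i, PowerSeries.constantCoeff (y' i) = t (f' i)) (s : R)
    (h : eigenvalueH (incl R (const β)) (incl R PowerSeries.X) (fun j => incl R (const (t j)))
        (specShift (const s)) (fun i => incl R (y i)) =
      eigenvalueH (incl R (const β)) (incl R PowerSeries.X) (fun j => incl R (const (t j)))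
        (specShift (const s)) (fun i => incl R (y' i))) :
    Set.range f ⊆ Set.range f' := by
  have hne : ∀ {y : Fin m → PowerSeries R}, (∀ i, IsUnit (1 + const β * y i)) → ∀ i,
      1 + incl R (const β) * incl R (y i) ≠ 0 := fun hy i => by
    simpa using ((hy i).map (incl R)).ne_zero
  have e₁ := eigenvalueH_eq (q := incl R PowerSeries.X) (incl_param_ne_zero ht) (hne hy.2.1)
    (x := specShift (const s)) fun i => specShift_ne_incl _ _
  have e₂ := eigenvalueH_eq (q := incl R PowerSeries.X) (incl_param_ne_zero ht) (hne hy'.2.1)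
    (x := specShift (const s)) fun i => specShift_ne_incl _ _
  rw [h] at e₁
  have key : ((∏ i, (1 + incl R (const β) * incl R (y i))) *
        ∏ j, (specShift (const s) - incl R (const (t j))) +
        (-1) ^ m * incl R PowerSeries.X * (∏ j, (1 + incl R (const β) * incl R (const (t j)))) *
          (1 + incl R (const β) * specShift (const s)) ^ m) *
            ∏ i, (specShift (const s) - incl R (y' i)) =
      ((∏ i, (1 + incl R (const β) * incl R (y' i))) *
        ∏ j, (specShift (const s) - incl R (const (t j))) +
        (-1) ^ m * incl R PowerSeries.X * (∏ j, (1 + incl R (const β) * incl R (const (t j)))) *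
          (1 + incl R (const β) * specShift (const s)) ^ m) *
            ∏ i, (specShift (const s) - incl R (y i)) := by
    rw [← e₁, ← e₂]
    ring
  have hpoly : ∀ a : PowerSeries R, incl R a =
      algebraMap (Polynomial (PowerSeries R)) (SpecField R) (Polynomial.C a) := fun _ => rfl
  simp only [hpoly, specShift, ← map_one (algebraMap (Polynomial (PowerSeries R)) (SpecField R)),
    ← map_neg, ← map_mul, ← map_add, ← map_sub, ← map_prod, ← map_pow] at key
  have key' := congrArg (Polynomial.map (PowerSeries.constantCoeff (R := R)))
    (IsFractionRing.injective (Polynomial (PowerSeries R)) (SpecField R) key)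
  simp only [Polynomial.map_mul, Polynomial.map_add, Polynomial.map_sub, Polynomial.map_prod,
    Polynomial.map_pow, Polynomial.map_neg, Polynomial.map_one, Polynomial.map_C, Polynomial.map_X,
    map_mul, PowerSeries.constantCoeff_X, const, PowerSeries.constantCoeff_C, hyf, hyf', map_zero, mul_zero,
    zero_mul, add_zero] at key'
  have hprod : ∏ j, (Polynomial.X + Polynomial.C s - Polynomial.C (t j)) ≠ 0 := by
    refine Finset.prod_ne_zero_iff.2 fun j _ h0 => ?_
    have := congrArg (Polynomial.coeff · 1) h0
    simp at this
  have key'' : (∏ i, (1 + Polynomial.C β * Polynomial.C (t (f i)))) *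
      ∏ i, (Polynomial.X + Polynomial.C s - Polynomial.C (t (f' i))) =
      (∏ i, (1 + Polynomial.C β * Polynomial.C (t (f' i)))) *
      ∏ i, (Polynomial.X + Polynomial.C s - Polynomial.C (t (f i))) := by
    apply mul_left_cancel₀ hprod
    -- The common factor from the inhomogeneities is a nonzero polynomial and cancels.
    linear_combination key'
  rintro _ ⟨i, rfl⟩
  have hev := congrArg (Polynomial.eval (t (f i) - s)) key''
  simp only [Polynomial.eval_mul, Polynomial.eval_prod, Polynomial.eval_add, Polynomial.eval_sub,
    Polynomial.eval_X, Polynomial.eval_C, Polynomial.eval_one, sub_add_cancel] at hev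
  have hzero : ∏ l, (t (f i) - t (f l)) = 0 := Finset.prod_eq_zero (Finset.mem_univ i) (sub_self _)
  rw [hzero, mul_zero, mul_eq_zero] at hev
  have hu : IsUnit (∏ i, (1 + β * t (f i))) := by
    rw [IsUnit.prod_univ_iff]; exact fun i => ht _
  obtain ⟨l, -, hl⟩ := Finset.prod_eq_zero_iff.1 (hev.resolve_left hu.ne_zero)
  exact ⟨l, (injective_of_isUnit_sub hd (sub_eq_zero.1 hl)).symm⟩

end OnShell

end

section

variable {N m n : ℕ}

/-! ### The remaining families -/

/-- Rescaling rows and columns and relabelling them changes the determinant by these factors and a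
sign. A unit product then forces the original determinant to be a unit. -/
theorem isUnit_of_conjugate {A ι κ : Type*} [CommRing A] [Fintype ι] [DecidableEq ι] [Fintype κ]
    [DecidableEq κ] {M : Matrix ι ι A} {M' : Matrix κ κ A} {e e' : ι ≃ κ} {c h : ι → A}
    (hh : ∀ i, IsUnit (h i))
    (hM : ∀ i j, c i * M i j = h j * M' (e i) (e' j)) (hM' : IsUnit M') : IsUnit M := by
  rw [Matrix.isUnit_iff_isUnit_det]
  have h₁ : Matrix.of (fun i j => c i * M i j) = Matrix.of (fun i j => h j * M'.submatrix e e' i j) :=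
    Matrix.ext fun i j => hM i j
  have h₂ := congrArg Matrix.det h₁
  rw [Matrix.det_mul_column, Matrix.det_mul_row] at h₂
  have h₃ : IsUnit (M'.submatrix e e').det := by
    rw [← Matrix.isUnit_iff_isUnit_det, Matrix.isUnit_submatrix_equiv]
    exact hM'
  have h₄ : IsUnit (∏ i, h i) := by rw [IsUnit.prod_univ_iff]; exact hh
  have h₅ := h₄.mul h₃
  rw [← h₂] at h₅
  exact isUnit_of_mul_isUnit_right h₅

/-- Reversal of the order of the sites. -/
def revSpin (N n : ℕ) : {b : Spin N // weight b = n} ≃ {b : Spin N // weight b = n} :=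
  (Equiv.arrowCongr Fin.revPerm (Equiv.refl (Fin 2))).subtypeEquiv fun b =>
    iff_of_eq (congrArg (· = n) (Equiv.sum_comp Fin.revPerm fun j => (b j : ℕ)).symm)

/-- Particle-hole duality on the strings of a given weight. -/
def holeEquiv (n k : ℕ) : {b : Spin (n + k) // weight b = n} ≃ {b : Spin (n + k) // weight b = k} :=
  hole.subtypeEquiv fun b => by have := weight_hole b; omega

section

variable {R : Type*} [CommRing R] [IsDomain R] {β : R} {t : Fin N → R}

theorem isUnit_coordMatrix_dual (ht : ∀ j, IsUnit (1 + β * t j))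
    (hd : ∀ i j, i ≠ j → IsUnit (t i - t j))
    {y : {b : Spin N // weight b = n} → Fin n → PowerSeries R}
    (hy : ∀ μ, IsRootsY (const β) PowerSeries.X (fun j => const (t j)) (y μ))
    (hrange : Function.Injective fun μ => Set.range (y μ)) :
    IsUnit (coordMatrix fun μ => dualBetheY (const β) (fun j => const (t j)) (y μ)) := by
  have h := isUnit_coordMatrix (t := t ∘ Fin.rev) (fun j => ht j.rev)
    (fun i j hij => hd _ _ (Fin.rev_injective.ne hij)) (y := fun μ => y μ ∘ Fin.rev)
    (fun μ => (hy μ).comp_rev) (fun μ ν hμν => hrange (by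
      simpa only [Fin.rev_surjective.range_comp] using hμν))
  refine isUnit_of_conjugate (e := Equiv.refl _) (e' := revSpin N n)
    (c := fun μ => ∏ i, (1 + const β * y μ i))
    (h := fun b => gauge (const β) (fun j => const (t j)) b.1) (fun b => isUnit_gauge (fun j => isUnit_const (ht j)) _)
    (fun μ b => ?_) h
  exact dualBetheY_eq (fun j => isUnit_const (ht j)) (y μ) b.1

theorem dualBetheY_mem (ht : ∀ j, IsUnit (1 + β * t j)) {y : Fin m → PowerSeries R}
    (hy : IsRootsY (const β) PowerSeries.X (fun j => const (t j)) y) :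
    dualBetheY (const β) (fun j => const (t j)) y ∈ weightSpace N m (PowerSeries R) := by
  refine mem_weightSpace_iff.2 fun b hb => ?_
  have hu : IsUnit (∏ i, (1 + const β * y i)) := by
    rw [IsUnit.prod_univ_iff]; exact hy.2.1
  have h := dualBetheY_eq (fun j => isUnit_const (ht j)) y b
  have h' := weight_betheY (right_ne_zero_of_mul (h ▸ mul_ne_zero hu.ne_zero hb))
  rw [← h']
  exact (Equiv.sum_comp Fin.revPerm fun j => (b j : ℕ)).symm

theorem extend_mem {v : Spin N → PowerSeries R} (hv : v ∈ weightSpace N n (PowerSeries R)) :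
    extend v ∈ weightSpace N n (SpecField R) := by
  rw [mem_weightSpace_iff] at hv ⊢
  exact fun b hb => hv b fun h => hb (by rw [extend, h, map_zero])

theorem isBasisOf_extend {v : {b : Spin N // weight b = n} → Spin N → PowerSeries R}
    (hv : ∀ μ, v μ ∈ weightSpace N n (PowerSeries R)) (h : IsUnit (coordMatrix v)) :
    IsBasisOf (fun μ => extend (v μ)) (weightSpace N n (SpecField R)) :=
  isBasisOf_of_isUnit (fun μ => extend_mem (hv μ)) (h.map (incl R).mapMatrix)

/-- Every solution of the Bethe equations is a member of a complete family of solutions. -/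
theorem exists_complete_family (ht : ∀ j, IsUnit (1 + β * t j))
    (hd : ∀ i j, i ≠ j → IsUnit (t i - t j)) {y : Fin n → PowerSeries R}
    (hy : IsRootsY (const β) PowerSeries.X (fun j => const (t j)) y) :
    ∃ (Y : {b : Spin N // weight b = n} → Fin n → PowerSeries R) (μ : {b : Spin N // weight b = n}),
      Y μ = y ∧ (∀ ν, IsRootsY (const β) PowerSeries.X (fun j => const (t j)) (Y ν)) ∧
      Function.Injective fun ν => Set.range (Y ν) := by
  classical
  obtain ⟨f, hf, hyf⟩ := hy.exists_leading_injective ht hd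
  have hcard : ∀ ν : {b : Spin N // weight b = n}, (spinSupport ν.1).card = n := fun ν => by
    rw [card_spinSupport, ν.2]
  obtain ⟨b, hb⟩ := spinSupport_surjective (Finset.univ.image f)
  let μ : {b : Spin N // weight b = n} := ⟨b, by
    rw [← card_spinSupport, hb, Finset.card_image_of_injective _ hf]; simp⟩
  -- The increasing enumeration is replaced at `μ` by `f` itself, so that the given `y` is recovered
  -- exactly and not only up to permutation.
  let F : {b : Spin N // weight b = n} → Fin n → Fin N :=
    Function.update (fun ν => (spinSupport ν.1).orderEmbOfFin (hcard ν)) μ f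
  have hFr : ∀ ν, Set.range (F ν) = spinSupport ν.1 := by
    intro ν
    by_cases h : ν = μ
    · subst h
      simp [F, μ, hb]
    · simp only [F, Function.update_of_ne h]
      exact Finset.range_orderEmbOfFin _ _
  have hFi : ∀ ν, Function.Injective (F ν) := by
    intro ν
    by_cases h : ν = μ
    · subst h
      simpa [F] using hf
    · simp only [F, Function.update_of_ne h]
      exact RelEmbedding.injective _
  choose Y hY hYF using fun ν => exists_bethe_solution ht hd (hFi ν)
  refine ⟨Y, μ, bethe_solution_unique ht hd (hY μ) hy fun i => ?_, hY, fun ν ν' h => ?_⟩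
  · rw [hYF, hyf]
    simp [F]
  · have := (range_eq_iff_of_leading ht hd (hY ν) (hY ν') (hFi ν) (hFi ν') (hYF ν) (hYF ν')).1 h
    rw [hFr, hFr] at this
    exact Subtype.ext (spinSupport_injective (Finset.coe_injective this))

/-- H is taken at `x + 1` and E at `x`: this guarantees commutation, while the eigenvalues of H at
`x + 1` still separate the members of a complete family. -/
theorem exists_isEigenpair_specE (ht : ∀ j, IsUnit (1 + β * t j))
    (hd : ∀ i j, i ≠ j → IsUnit (t i - t j)) {y : Fin n → PowerSeries R}
    (hy : IsRootsY (const β) PowerSeries.X (fun j => const (t j)) y) :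
    ∃ ε, IsEigenpair (specE β t) (extend (betheY (const β) (fun j => const (t j)) y))
      (extend (dualBetheY (const β) (fun j => const (t j)) y)) ε := by
  obtain ⟨Y, μ, rfl, hY, hrange⟩ := exists_complete_family ht hd hy
  choose f hf hYf using fun ν => (hY ν).exists_leading_injective ht hd
  have hmem : ∀ ν, betheY (const β) (fun j => const (t j)) (Y ν) ∈
      weightSpace N n (PowerSeries R) := fun ν => mem_weightSpace_iff.2 fun b => weight_betheY
  refine exists_common_eigenvalue
    (H := transferH (incl R (const β)) (incl R PowerSeries.X) (fun j => incl R (const (t j)))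
      (specShift (const 1)))
    (Λ := fun ν => eigenvalueH (incl R (const β)) (incl R PowerSeries.X)
      (fun j => incl R (const (t j))) (specShift (const 1)) (fun i => incl R (Y ν i)))
    (transfer_commute (fun j => (incl_param_ne_zero ht j).isUnit) _ _ _ ?_) ?_
    (isBasisOf_extend hmem (isUnit_coordMatrix ht hd hY hrange))
    (w := fun ν => extend (dualBetheY (const β) (fun j => const (t j)) (Y ν)))
    (fun ν => extend_mem (dualBetheY_mem ht (hY ν)))
    (fun ν => transferH_mulVec_extend ht (hY ν) _)
    (fun ν => extend_vecMul_transferH ht (hY ν) _) (fun b b' => weight_transferE) μ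
  · rw [show (const 1 : PowerSeries R) = 1 from map_one _]
    exact (oplus_specShift_ne_zero _).isUnit
  · intro ν ν' h
    refine hrange ((range_eq_iff_of_leading ht hd (hY ν) (hY ν') (hf ν) (hf ν') (hYf ν) (hYf ν')).2
      (Set.Subset.antisymm ?_ ?_))
    · exact range_subset_of_eigenvalueH_eq ht hd (hY ν) (hY ν') (hYf ν) (hYf ν') 1 h
    · exact range_subset_of_eigenvalueH_eq ht hd (hY ν') (hY ν) (hYf ν') (hYf ν) 1 h.symm

theorem IsEigenpair.hole {A : Type*} [CommRing A] {T T' : Op N A}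
    {v v' w w' : Spin N → A} {Λ : A} (h : IsEigenpair T' v' w' Λ)
    (hT : ∀ b b', T b b' = T' (hole b) (hole b')) (hv : ∀ b, v b = v' (BetheAnsatz.hole b))
    (hw : ∀ b, w b = w' (BetheAnsatz.hole b)) : IsEigenpair T v w Λ := by
  refine ⟨funext fun b => ?_, funext fun b => ?_⟩
  · rw [mulVec_hole hT hv, h.1, Pi.smul_apply, Pi.smul_apply, hv]
  · rw [vecMul_hole hT hw, h.2, Pi.smul_apply, Pi.smul_apply, hw]

theorem const_dualParam {R : Type*} [CommRing R] {β : R} {t : Fin N → R}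
    (ht : ∀ j, IsUnit (1 + β * t j)) :
    (fun j => const (dualParam β t j)) = dualParam (const β) fun j => const (t j) :=
  funext fun j => map_dualParam PowerSeries.C ht j

theorem incl_const_dualParam (ht : ∀ j, IsUnit (1 + β * t j)) :
    (fun j => incl R (const (dualParam β t j))) =
      dualParam (incl R (const β)) fun j => incl R (const (t j)) :=
  funext fun j => map_dualParam ((incl R).comp PowerSeries.C) ht j

theorem extend_betheZ (ht : ∀ j, IsUnit (1 + β * t j)) (z : Fin m → PowerSeries R) (b : Spin N) :
    extend (betheZ (const β) (fun j => const (t j)) z) b =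
      extend (betheY (const β) (fun j => const (dualParam β t j)) z) (hole b) := by
  rw [const_dualParam ht]
  exact congrArg (incl R) (betheZ_eq (fun j => isUnit_const (ht j)) z b)

theorem extend_dualBetheZ (ht : ∀ j, IsUnit (1 + β * t j)) (z : Fin m → PowerSeries R)
    (b : Spin N) :
    extend (dualBetheZ (const β) (fun j => const (t j)) z) b =
      extend (dualBetheY (const β) (fun j => const (dualParam β t j)) z) (hole b) := by
  rw [const_dualParam ht]
  exact congrArg (incl R) (dualBetheZ_eq (fun j => isUnit_const (ht j)) z b)

theorem specE_apply (ht : ∀ j, IsUnit (1 + β * t j)) (b b' : Spin N) :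
    specE β t b b' = specH β (dualParam β t) (hole b) (hole b') := by
  rw [specE, specH, incl_const_dualParam ht]
  exact transferE_eq (fun j => (incl_param_ne_zero ht j).isUnit) _ _ b b'

theorem specH_apply (ht : ∀ j, IsUnit (1 + β * t j)) (b b' : Spin N) :
    specH β t b b' = specE β (dualParam β t) (hole b) (hole b') := by
  rw [specE, specH, incl_const_dualParam ht]
  exact transferH_eq (fun j => (incl_param_ne_zero ht j).isUnit) _ _ b b'

theorem onShellE_eq (ht : ∀ j, IsUnit (1 + β * t j)) (z : Fin m → PowerSeries R) :
    onShellE β t z = onShellH β (dualParam β t) z := by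
  rw [onShellE, onShellH, incl_const_dualParam ht]
  exact eigenvalueE_eq (fun j => (incl_param_ne_zero ht j).isUnit) _ _

theorem isRootsZ_const_iff {R : Type*} [CommRing R] {β : R} {t : Fin N → R}
    (ht : ∀ j, IsUnit (1 + β * t j)) (z : Fin m → PowerSeries R) :
    IsRootsZ (const β) PowerSeries.X (fun j => const (t j)) z ↔
      IsRootsY (const β) PowerSeries.X (fun j => const (dualParam β t j)) z := by
  rw [const_dualParam ht]
  exact isRootsZ_iff (fun j => isUnit_const (ht j)) z

theorem isBasisOf_betheY (ht : ∀ j, IsUnit (1 + β * t j))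
    (hd : ∀ i j, i ≠ j → IsUnit (t i - t j))
    {y : {b : Spin N // weight b = n} → Fin n → PowerSeries R}
    (hy : ∀ μ, IsRootsY (const β) PowerSeries.X (fun j => const (t j)) (y μ))
    (hrange : Function.Injective fun μ => Set.range (y μ)) :
    IsBasisOf (fun μ => betheY (const β) (fun j => const (t j)) (y μ))
        (weightSpace N n (PowerSeries R)) ∧
      IsBasisOf (fun μ => dualBetheY (const β) (fun j => const (t j)) (y μ))
        (weightSpace N n (PowerSeries R)) :=
  ⟨isBasisOf_of_isUnit (fun _ => mem_weightSpace_iff.2 fun _ => weight_betheY)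
      (isUnit_coordMatrix ht hd hy hrange),
    isBasisOf_of_isUnit (fun μ => dualBetheY_mem ht (hy μ)) (isUnit_coordMatrix_dual ht hd hy hrange)⟩

/-- Duality permutes the coordinates and carries strings of weight `k` to strings of weight `n`, so
the coordinate matrices differ only by relabelling. -/
theorem isBasisOf_of_hole {k : ℕ} {A : Type*} [CommRing A]
    {v : {b : Spin (n + k) // weight b = n} → Spin (n + k) → A}
    {v' : {b : Spin (n + k) // weight b = k} → Spin (n + k) → A}
    (h : ∀ μ b, v μ b = v' (holeEquiv n k μ) (hole b))
    (hv' : ∀ μ, v' μ ∈ weightSpace (n + k) k A) (hu : IsUnit (coordMatrix v')) :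
    IsBasisOf v (weightSpace (n + k) n A) := by
  refine isBasisOf_of_isUnit (fun μ => mem_weightSpace_iff.2 fun b hb => ?_)
    (isUnit_of_conjugate (e := holeEquiv n k) (e' := holeEquiv n k) (c := fun _ => 1)
      (h := fun _ => 1) (fun _ => isUnit_one) (fun μ b => ?_) hu)
  · have := mem_weightSpace_iff.1 (hv' (holeEquiv n k μ)) (hole b) (by rwa [← h])
    have := weight_hole b
    omega
  · rw [one_mul, one_mul]
    exact h μ b.1

theorem isBasisOf_betheZ {k : ℕ} {t : Fin (n + k) → R} (ht : ∀ j, IsUnit (1 + β * t j))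
    (hd : ∀ i j, i ≠ j → IsUnit (t i - t j))
    {z : {b : Spin (n + k) // weight b = n} → Fin k → PowerSeries R}
    (hz : ∀ μ, IsRootsZ (const β) PowerSeries.X (fun j => const (t j)) (z μ))
    (hrange : Function.Injective fun μ => Set.range (z μ)) :
    IsBasisOf (fun μ => betheZ (const β) (fun j => const (t j)) (z μ))
        (weightSpace (n + k) n (PowerSeries R)) ∧
      IsBasisOf (fun μ => dualBetheZ (const β) (fun j => const (t j)) (z μ))
        (weightSpace (n + k) n (PowerSeries R)) := by
  have ht' := isUnit_dualParam ht
  have hd' := isUnit_dualParam_sub ht hd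
  set y := fun μ => z ((holeEquiv n k).symm μ) with hy
  have hyr : ∀ μ, IsRootsY (const β) PowerSeries.X (fun j => const (dualParam β t j)) (y μ) :=
    fun μ => (isRootsZ_const_iff ht _).1 (hz _)
  have hyi : Function.Injective fun μ => Set.range (y μ) :=
    hrange.comp (holeEquiv n k).symm.injective
  have hyz : ∀ μ, y (holeEquiv n k μ) = z μ := fun μ => by
    rw [hy]; simp only [Equiv.symm_apply_apply]
  refine ⟨isBasisOf_of_hole
      (v' := fun μ => betheY (const β) (fun j => const (dualParam β t j)) (y μ)) (fun μ b => ?_)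
      (fun μ => mem_weightSpace_iff.2 fun b => weight_betheY) (isUnit_coordMatrix ht' hd' hyr hyi),
    isBasisOf_of_hole
      (v' := fun μ => dualBetheY (const β) (fun j => const (dualParam β t j)) (y μ)) (fun μ b => ?_)
      (fun μ => dualBetheY_mem ht' (hyr μ)) (isUnit_coordMatrix_dual ht' hd' hyr hyi)⟩
  · rw [hyz, const_dualParam ht]
    exact betheZ_eq (fun j => isUnit_const (ht j)) _ _
  · rw [hyz, const_dualParam ht]
    exact dualBetheZ_eq (fun j => isUnit_const (ht j)) _ _

end

end

end BetheAnsatz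

end

/-! ### The theorem -/

open BetheAnsatz in
theorem mainTheorem5 {R : Type*} [CommRing R] [IsDomain R] (n k : ℕ) (β : R)
    (t : Fin (n + k) → R) (hunit : ∀ j, IsUnit (1 + β * t j))
    (hdiff : ∀ i j, i ≠ j → IsUnit (t i - t j)) :
    -- the number of solutions, up to permutation of the entries
    {S : Set (PowerSeries R) | ∃ y : Fin n → PowerSeries R,
        IsRootsY (const β) PowerSeries.X (fun j => const (t j)) y ∧ Set.range y = S}.ncard
      = (n + k).choose n ∧
    {S : Set (PowerSeries R) | ∃ z : Fin k → PowerSeries R,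
        IsRootsZ (const β) PowerSeries.X (fun j => const (t j)) z ∧ Set.range z = S}.ncard
      = (n + k).choose n ∧
    -- eigenvalue equations for `|y⟩` and `⟨y|`
    (∀ y : Fin n → PowerSeries R,
      IsRootsY (const β) PowerSeries.X (fun j => const (t j)) y →
      IsEigenpair (specH β t)
        (extend (betheY (const β) (fun j => const (t j)) y))
        (extend (dualBetheY (const β) (fun j => const (t j)) y)) (onShellH β t y) ∧
      ∃ ε : SpecField R, IsEigenpair (specE β t)
        (extend (betheY (const β) (fun j => const (t j)) y))
        (extend (dualBetheY (const β) (fun j => const (t j)) y)) ε) ∧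
    -- eigenvalue equations for `|z⟩` and `⟨z|`
    (∀ z : Fin k → PowerSeries R,
      IsRootsZ (const β) PowerSeries.X (fun j => const (t j)) z →
      IsEigenpair (specE β t)
        (extend (betheZ (const β) (fun j => const (t j)) z))
        (extend (dualBetheZ (const β) (fun j => const (t j)) z)) (onShellE β t z) ∧
      ∃ ε : SpecField R, IsEigenpair (specH β t)
        (extend (betheZ (const β) (fun j => const (t j)) z))
        (extend (dualBetheZ (const β) (fun j => const (t j)) z)) ε) ∧
    -- `|y_μ⟩` and `⟨y_μ|` form bases of `V_n` and of its dual over `R⟦q⟧`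
    (∀ y : {b : Spin (n + k) // weight b = n} → Fin n → PowerSeries R,
      (∀ μ, IsRootsY (const β) PowerSeries.X (fun j => const (t j)) (y μ)) →
      (Function.Injective fun μ => Set.range (y μ)) →
      IsBasisOf (fun μ => betheY (const β) (fun j => const (t j)) (y μ))
          (weightSpace (n + k) n (PowerSeries R)) ∧
        IsBasisOf (fun μ => dualBetheY (const β) (fun j => const (t j)) (y μ))
          (weightSpace (n + k) n (PowerSeries R))) ∧
    -- `|z_μ⟩` and `⟨z_μ|` form bases of `V_n` and of its dual over `R⟦q⟧`
    (∀ z : {b : Spin (n + k) // weight b = n} → Fin k → PowerSeries R,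
      (∀ μ, IsRootsZ (const β) PowerSeries.X (fun j => const (t j)) (z μ)) →
      (Function.Injective fun μ => Set.range (z μ)) →
      IsBasisOf (fun μ => betheZ (const β) (fun j => const (t j)) (z μ))
          (weightSpace (n + k) n (PowerSeries R)) ∧
        IsBasisOf (fun μ => dualBetheZ (const β) (fun j => const (t j)) (z μ))
          (weightSpace (n + k) n (PowerSeries R))) := by
  have ht' := isUnit_dualParam hunit
  have hd' := isUnit_dualParam_sub hunit hdiff
  refine ⟨ncard_bethe_solutions hunit hdiff n, ?_,
    fun y hy => ⟨isEigenpair_specH hunit hy, exists_isEigenpair_specE hunit hdiff hy⟩,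
    fun z hz => ?_, fun y hy hrange => isBasisOf_betheY hunit hdiff hy hrange,
    fun z hz hrange => isBasisOf_betheZ hunit hdiff hz hrange⟩
  -- Duality counts `k`-element sets of the `n + k` sites, which is the same binomial coefficient.
  · simp only [isRootsZ_const_iff hunit]
    rw [ncard_bethe_solutions ht' hd' k, Nat.choose_symm_add]
  · have hz' := (isRootsZ_const_iff hunit z).1 hz
    obtain ⟨ε, hε⟩ := exists_isEigenpair_specE ht' hd' hz'
    refine ⟨?_, ε, hε.hole (specH_apply hunit) (extend_betheZ hunit z)
      (extend_dualBetheZ hunit z)⟩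
    rw [onShellE_eq hunit]
    exact (isEigenpair_specH ht' hz').hole (specE_apply hunit) (extend_betheZ hunit z)
      (extend_dualBetheZ hunit z)
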